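/- **Setting.** There are $n$ buyers and $m$ sellers. Buyer $i$ wants one item and has value $b_i$; seller $j$ owns one item and has value $s_j$. All values are independent; $b_i$ and $s_j$ are drawn from arbitrary probability distributions with finite supports $T^B_i,T^S_j\subset[0,\infty)$, known to the designer. A non-empty family $\mathcal F$ of feasible sets of buyer–seller pairs is given; every $S\in\mathcal F$ is a matching, and $\mathcal F$ is downward closed. A mechanism assigns to each type profile $(\mathbf b,\mathbf s)$ a probability distribution over matchings in $\mathcal F$ (the pairs that trade), an (expected) payment $p^B_i(\mathbf b,\mathbf s)\in\mathbb R$ of every buyer $i$ and an (expected) gain $p^S_j(\mathbf b,\mathbf s)\in\mathbb R$ of every seller $j$. With $x^B_i,x^S_j$ the probabilities that $i$ and $j$ trade, the utilities are $b_ix^B_i-p^B_i$ and $p^S_j-s_jx^S_j$. The mechanism is *IR* (resp. *BIC*) if for each agent and each of her types, the expected utility of truthful reporting, over the other agents' types, is non-negative (resp. at least that of reporting any other type in her support). It is *SBB* (strongly budget balanced) if $\sum_ip^B_i=\sum_jp^S_j$ at every type profile, and *ex-ante WBB* (weakly budget balanced) if $\mathbb E[\sum_ip^B_i]\ge\mathbb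 E[\sum_jp^S_j]$. Its *gains from trade* are $\mathrm{GFT}=\mathbb E[\sum_{(i,j)\text{ trades}}(b_i-s_j)]$. $\mathrm{OPT}$ is the supremum of the $\mathrm{GFT}$ of all IR, BIC, ex-ante WBB mechanisms. **Ironed virtual values.** For buyer $i$ and $t\in T^B_i$ let $Q(t)=\Pr[b_i\ge t]$, and let $\tilde R(t)$ be the value at $Q(t)$ of the upper concave envelope of the points $(Q(r),\,rQ(r))$, $r\in T^B_i$. If $t^+$ is the next larger element of $T^B_i$, then $\tilde\varphi_i(t)=\frac{\tilde R(t)-\tilde R(t^+)}{Q(t)-Q(t^+)}$; if $t=\max T^B_i$, then $\tilde\varphi_i(t)=t$. For seller $j$ and $t\in T^S_j$ let $F(t)=\Pr[s_j\le t]$, and let $\tilde U(t)$ be the value at $F(t)$ of the lower convex envelope of the points $(F(r),\,rF(r))$, $r\in T^S_j$. If $t^-$ is the next smaller element of $T^S_j$, then $\tilde\tau_j(t)=\frac{\tilde U(t)-\tilde U(t^-)}{F(t)-F(t^-)}$; if $t=\min T^S_j$, then $\tilde\tau_j(t)=t$. **GSOM and GBOM.** The Generalized Seller-Offering Mechanism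 (GSOM) lets the pairs in a matching $A\in\mathcal F$ maximizing $\sum_{(i,j)\in A}(\tilde\varphi_i(b_i)-s_j)$ trade; the Generalized Buyer-Offering Mechanism (GBOM) instead maximizes $\sum_{(i,j)\in A}(b_i-\tilde\tau_j(s_j))$. Ties are broken by an arbitrary fixed strict total order on matchings (e.g. lexicographically). Both use threshold payments: a buyer who trades pays the smallest type in her support at which she would still trade (the other types being fixed), a seller who trades receives the largest type in her support at which she would still trade, and an agent who does not trade pays or receives $0$. **SBB transformation** of a mechanism with payments $p^B,p^S$: keep the allocation rule; first replace $p^S_j$ by $p^S_j+\delta/m$ for all $j$ (no change if $m=0$), where $\delta=\mathbb E[\sum_ip^B_i-\sum_jp^S_j]$. For the resulting payments let $p^B_i(b_i),p^S_j(s_j)$ denote the interim expected payments and gains, $\bar p^B_i,\bar p^S_j$ the ex-ante expected ones, and $\Omega^B,\Omega^S$ the sets of buyers and sellers for which the latter are positive. Then put $$\kappa(\mathbf b,\mathbf s)=\prod_{i\in\Omega^B}\frac{p^B_i(b_i)}{\bar p^B_i}\prod_{j\in\Omega^S}\frac{p^S_j(s_j)}{\bar p^S_j},$$ and let the new payment of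 $i\in\Omega^B$ be $\kappa(\mathbf b,\mathbf s)\,\bar p^B_i$, the new gain of $j\in\Omega^S$ be $\kappa(\mathbf b,\mathbf s)\,\bar p^S_j$, and that of all other agents $0$. **Theorem.** In every such double auction, $\mathrm{OPT}$ is finite, and there is an IR, BIC and SBB mechanism whose expected gains from trade are at least $\mathrm{OPT}/2$. Namely, the mechanism obtained by applying the SBB transformation to whichever of GSOM and GBOM has the larger expected gains from trade (GSOM if they are equal) has these properties. -/

import Mathlib

open scoped BigOperators

noncomputable section

namespace DoubleAuction

/-- A discrete value distribution: a probability mass function `mass` on a finite set `supp` of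
non-negative reals, positive exactly on `supp`. -/
structure ValueDist where
  supp : Finset ℝ
  mass : ℝ → ℝ
  nonneg : ∀ t ∈ supp, 0 ≤ t
  mass_pos : ∀ t ∈ supp, 0 < mass t
  mass_zero : ∀ t, t ∉ supp → mass t = 0
  mass_sum : ∑ t ∈ supp, mass t = 1

namespace ValueDist

variable (d : ValueDist)

/-- The probability of drawing a value `≤ t` (the distribution function `F`). -/
def cdf (t : ℝ) : ℝ := ∑ r ∈ d.supp with r ≤ t, d.mass r

/-- The probability of drawing a value `≥ t`. -/
def tail (t : ℝ) : ℝ := ∑ r ∈ d.supp with t ≤ r, d.mass r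

/-- The revenue curve at quantile `tail t`: expected revenue of the posted price `t`. -/
def revenue (t : ℝ) : ℝ := t * d.tail t

/-- The ironed revenue curve at quantile `tail t`: the upper concave envelope of the points
`(tail r, revenue r)`, `r ∈ supp`. -/
def ironedRevenue (t : ℝ) : ℝ :=
  sSup {y | ∃ t₁ ∈ d.supp, ∃ t₂ ∈ d.supp, ∃ δ ∈ Set.Icc (0 : ℝ) 1,
    d.tail t = δ * d.tail t₁ + (1 - δ) * d.tail t₂ ∧
    y = δ * d.revenue t₁ + (1 - δ) * d.revenue t₂}

/-- Myerson's ironed virtual value of a buyer at a type `t ∈ supp`: the slope of the ironed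
revenue curve between the quantiles of `t` and of the next larger type; at the largest type it is
`t` itself. -/
def ironedPhi (t : ℝ) : ℝ :=
  if h : (d.supp.filter (fun r => t < r)).Nonempty then
    (d.ironedRevenue t - d.ironedRevenue ((d.supp.filter (fun r => t < r)).min' h)) /
      (d.tail t - d.tail ((d.supp.filter (fun r => t < r)).min' h))
  else t

/-- The cost curve `U(q) = q · F⁻¹(q)` at `q = F(t)`, `t ∈ supp`. -/
def cost (t : ℝ) : ℝ := d.cdf t * t

/-- The ironed cost curve at quantile `F(t)`: the lower convex envelope of the points
`(F(r), U(F(r)))`, `r ∈ supp`. -/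
def ironedCost (t : ℝ) : ℝ :=
  sInf {y | ∃ t₁ ∈ d.supp, ∃ t₂ ∈ d.supp, ∃ δ ∈ Set.Icc (0 : ℝ) 1,
    d.cdf t = δ * d.cdf t₁ + (1 - δ) * d.cdf t₂ ∧
    y = δ * d.cost t₁ + (1 - δ) * d.cost t₂}

/-- The ironed virtual value of a seller at a type `t ∈ supp`: the slope of the ironed cost curve
between the quantiles of the next smaller type and of `t`; at the smallest type it is `t`. -/
def ironedTau (t : ℝ) : ℝ :=
  if h : (d.supp.filter (fun r => r < t)).Nonempty then
    (d.ironedCost t - d.ironedCost ((d.supp.filter (fun r => r < t)).max' h)) /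
      (d.cdf t - d.cdf ((d.supp.filter (fun r => r < t)).max' h))
  else t

end ValueDist

/-- A double auction with `n` unit-demand buyers and `m` unit-supply sellers: independent value
distributions and a (non-empty) downward-closed family `feasible` of matchings. -/
structure Market (n m : ℕ) where
  buyer : Fin n → ValueDist
  seller : Fin m → ValueDist
  feasible : Finset (Finset (Fin n × Fin m))
  feasible_nonempty : feasible.Nonempty
  matching_buyer : ∀ S ∈ feasible, ∀ i j j', (i, j) ∈ S → (i, j') ∈ S → j = j'
  matching_seller : ∀ S ∈ feasible, ∀ i i' j, (i, j) ∈ S → (i', j) ∈ S → i = i'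
  downward_closed : ∀ S ∈ feasible, ∀ S' ⊆ S, S' ∈ feasible

variable {n m : ℕ}

namespace Market

variable (D : Market n m)

/-- Buyers' type profiles: each buyer's type lies in the support of her distribution. -/
abbrev BProfile : Type := (i : Fin n) → (D.buyer i).supp

/-- Sellers' type profiles. -/
abbrev SProfile : Type := (j : Fin m) → (D.seller j).supp

/-- The probability of the type profile `(b, s)` (all types are independent). -/
def weight (b : D.BProfile) (s : D.SProfile) : ℝ :=
  (∏ i, (D.buyer i).mass (b i)) * ∏ j, (D.seller j).mass (s j)

/-- The expectation of `g (b, s)` over a random type profile `(b, s)`. -/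
def expect (g : D.BProfile → D.SProfile → ℝ) : ℝ :=
  ∑ b, ∑ s, D.weight b s * g b s

/-- `E_{b_{-i}, s} [g (t, b_{-i}, s)]`. As the types are independent, the expectation may run over
the whole profile, with buyer `i`'s entry overwritten by `t`. -/
def interimB (g : D.BProfile → D.SProfile → ℝ) (i : Fin n) (t : (D.buyer i).supp) : ℝ :=
  D.expect fun b s => g (Function.update b i t) s

/-- `E_{b, s_{-j}} [g (b, t, s_{-j})]`. -/
def interimS (g : D.BProfile → D.SProfile → ℝ) (j : Fin m) (t : (D.seller j).supp) : ℝ :=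
  D.expect fun b s => g b (Function.update s j t)

end Market

/-- A (direct, randomized) mechanism: at each type profile a lottery `prob` over the feasible
matchings, and the (expected) payment `payB` of each buyer and gain `payS` of each seller. -/
structure Mechanism (D : Market n m) where
  prob : D.BProfile → D.SProfile → Finset (Fin n × Fin m) → ℝ
  prob_nonneg : ∀ b s S, 0 ≤ prob b s S
  prob_zero : ∀ b s S, S ∉ D.feasible → prob b s S = 0
  prob_sum : ∀ b s, ∑ S ∈ D.feasible, prob b s S = 1
  payB : Fin n → D.BProfile → D.SProfile → ℝ
  payS : Fin m → D.BProfile → D.SProfile → ℝ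

namespace Mechanism

variable {D : Market n m} (M : Mechanism D)

/-- The probability that buyer `i` gets an item. -/
def xB (i : Fin n) (b : D.BProfile) (s : D.SProfile) : ℝ :=
  ∑ S ∈ D.feasible, M.prob b s S * if ∃ j, (i, j) ∈ S then 1 else 0

/-- The probability that seller `j` sells her item. -/
def xS (j : Fin m) (b : D.BProfile) (s : D.SProfile) : ℝ :=
  ∑ S ∈ D.feasible, M.prob b s S * if ∃ i, (i, j) ∈ S then 1 else 0

/-- Buyer `i`'s interim utility when her value is `v` and she reports `t`. -/
def utilB (i : Fin n) (v : ℝ) (t : (D.buyer i).supp) : ℝ :=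
  v * D.interimB (M.xB i) i t - D.interimB (M.payB i) i t

/-- Seller `j`'s interim utility when her value is `v` and she reports `t`. -/
def utilS (j : Fin m) (v : ℝ) (t : (D.seller j).supp) : ℝ :=
  D.interimS (M.payS j) j t - v * D.interimS (M.xS j) j t

/-- (Interim) individual rationality. -/
def IsIR : Prop :=
  (∀ i (t : (D.buyer i).supp), 0 ≤ M.utilB i t t) ∧
  (∀ j (t : (D.seller j).supp), 0 ≤ M.utilS j t t)

/-- Bayesian incentive compatibility. -/
def IsBIC : Prop :=
  (∀ i (t t' : (D.buyer i).supp), M.utilB i t t' ≤ M.utilB i t t) ∧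
  (∀ j (t t' : (D.seller j).supp), M.utilS j t t' ≤ M.utilS j t t)

/-- Strong budget balance. -/
def IsSBB : Prop := ∀ b s, ∑ i, M.payB i b s = ∑ j, M.payS j b s

/-- Ex-ante weak budget balance. -/
def IsExAnteWBB : Prop :=
  D.expect (fun b s => ∑ j, M.payS j b s) ≤ D.expect (fun b s => ∑ i, M.payB i b s)

/-- The expected gains from trade. -/
def GFT : ℝ :=
  D.expect fun b s => ∑ S ∈ D.feasible, M.prob b s S * ∑ e ∈ S, ((b e.1 : ℝ) - (s e.2 : ℝ))

/-- The expected surplus (buyers' payments minus sellers' gains). -/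
def surplus : ℝ := D.expect fun b s => ∑ i, M.payB i b s - ∑ j, M.payS j b s

/-- First step of the SBB transformation: the expected surplus is handed out to the sellers in
equal shares, independently of the reports. -/
def shareSurplus : Mechanism D :=
  { M with payS := fun j b s => M.payS j b s + M.surplus / m }

/-- The buyers whose expected payment is positive. -/
def activeB : Finset (Fin n) := Finset.univ.filter fun i => 0 < D.expect (M.payB i)

/-- The sellers whose expected gain is positive. -/
def activeS : Finset (Fin m) := Finset.univ.filter fun j => 0 < D.expect (M.payS j)

/-- The product over all active agents of (interim payment at the reported type) divided by
(expected payment). -/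
def balanceFactor (b : D.BProfile) (s : D.SProfile) : ℝ :=
  ((∏ i ∈ M.activeB, D.interimB (M.payB i) i (b i)) *
      ∏ j ∈ M.activeS, D.interimS (M.payS j) j (s j)) /
    ((∏ i ∈ M.activeB, D.expect (M.payB i)) * ∏ j ∈ M.activeS, D.expect (M.payS j))

/-- Second step of the SBB transformation: every active agent's payment at `(b, s)` becomes
`balanceFactor b s` times her expected payment, and the other agents' payments become `0`. -/
def balance : Mechanism D :=
  { M with
    payB := fun i b s => if i ∈ M.activeB then M.balanceFactor b s * D.expect (M.payB i) else 0
    payS := fun j b s => if j ∈ M.activeS then M.balanceFactor b s * D.expect (M.payS j) else 0 }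

/-- The SBB transformation: the allocation rule is kept, the payments are rebalanced. -/
def sbbTransform : Mechanism D := M.shareSurplus.balance

/-- The one of two mechanisms with the larger expected gains from trade. -/
def better (M₁ M₂ : Mechanism D) : Mechanism D := if M₂.GFT ≤ M₁.GFT then M₁ else M₂

end Mechanism

namespace Market

variable (D : Market n m)

/-- The feasible matchings of maximum total weight, for edge weights `w`. -/
def maximizers (w : Fin n × Fin m → ℝ) : Finset (Finset (Fin n × Fin m)) :=
  D.feasible.filter fun S => ∀ S' ∈ D.feasible, ∑ e ∈ S', w e ≤ ∑ e ∈ S, w e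

theorem maximizers_nonempty (w : Fin n × Fin m → ℝ) : (D.maximizers w).Nonempty := by
  obtain ⟨S, hS, h⟩ :=
    D.feasible.exists_max_image (fun S => ∑ e ∈ S, w e) D.feasible_nonempty
  exact ⟨S, Finset.mem_filter.2 ⟨hS, h⟩⟩

/-- The maximum weight feasible matching for edge weights `w`; among several, the first one in the
order given by `rank`. -/
def maxMatching (rank : Finset (Fin n × Fin m) → ℕ) (w : Fin n × Fin m → ℝ) :
    Finset (Fin n × Fin m) :=
  ((D.maximizers w).exists_min_image rank (D.maximizers_nonempty w)).choose

theorem maxMatching_mem (rank : Finset (Fin n × Fin m) → ℕ) (w : Fin n × Fin m → ℝ) :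
    D.maxMatching rank w ∈ D.feasible :=
  (Finset.mem_filter.1
    ((D.maximizers w).exists_min_image rank (D.maximizers_nonempty w)).choose_spec.1).1

/-- The deterministic mechanism with allocation rule `A` and threshold payments: a buyer who trades
pays the smallest type in her support at which she would still trade, a seller who trades receives
the largest type in her support at which she would still trade, all others pay or receive `0`. -/
def thresholdMechanism (A : D.BProfile → D.SProfile → Finset (Fin n × Fin m))
    (hA : ∀ b s, A b s ∈ D.feasible) : Mechanism D where
  prob b s S := if S = A b s then 1 else 0
  prob_nonneg b s S := by split_ifs <;> norm_num
  prob_zero b s S hS := if_neg fun (h : S = A b s) => hS (by rw [h]; exact hA b s)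
  prob_sum b s := by simp [hA b s]
  payB i b s :=
    if ∃ j, (i, j) ∈ A b s then
      sInf {v : ℝ | ∃ t : (D.buyer i).supp, (t : ℝ) = v ∧
        ∃ j, (i, j) ∈ A (Function.update b i t) s}
    else 0
  payS j b s :=
    if ∃ i, (i, j) ∈ A b s then
      sSup {v : ℝ | ∃ t : (D.seller j).supp, (t : ℝ) = v ∧
        ∃ i, (i, j) ∈ A b (Function.update s j t)}
    else 0

/-- The Generalized Seller-Offering Mechanism: maximum weight matching for the weights
`φ̃ᵢ(bᵢ) - sⱼ`, with threshold payments. -/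
def GSOM (rank : Finset (Fin n × Fin m) → ℕ) : Mechanism D :=
  D.thresholdMechanism
    (fun b s => D.maxMatching rank fun e => (D.buyer e.1).ironedPhi (b e.1) - (s e.2 : ℝ))
    (fun _ _ => D.maxMatching_mem _ _)

/-- The Generalized Buyer-Offering Mechanism: maximum weight matching for the weights
`bᵢ - τ̃ⱼ(sⱼ)`, with threshold payments. -/
def GBOM (rank : Finset (Fin n × Fin m) → ℕ) : Mechanism D :=
  D.thresholdMechanism
    (fun b s => D.maxMatching rank fun e => (b e.1 : ℝ) - (D.seller e.2).ironedTau (s e.2))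
    (fun _ _ => D.maxMatching_mem _ _)

/-- The expected gains from trade that IR, BIC, ex-ante WBB mechanisms achieve. -/
def achievableGFT : Set ℝ :=
  {g | ∃ M : Mechanism D, M.IsIR ∧ M.IsBIC ∧ M.IsExAnteWBB ∧ M.GFT = g}

/-- The best expected gains from trade of any IR, BIC, ex-ante WBB mechanism. -/
def OPT : ℝ := sSup D.achievableGFT

end Market

end DoubleAuction

end

/-!
The proof compares every mechanism with the two virtual-welfare maximizers.

*Ironing.* A seller with value `s` is a buyer with value `-s`, so one theory over a finite linear
order of types serves both sides (`IsIroned`). Concave envelopes are handled by supporting lines: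
they show that the ironed virtual value is monotone, is at most the value, and that the ironed
revenue curve touches the revenue curve wherever the ironed virtual value jumps. Summation by parts
then gives both halves of Myerson's lemma: under interim incentive constraints the expected payment
is at most the expected ironed virtual value of the allocation (`IsIroned.payment_le`), with
equality for a threshold price whose winning set does not split types of equal ironed virtual value
(`IsIroned.threshold_revenue`).

*Upper bound.* For an IR, BIC, ex-ante WBB mechanism the first half and budget balance give
`0 ≤ E ∑ (φ̃ᵢ - τ̃ⱼ)` over the traded pairs, so
`GFT ≤ E ∑ (bᵢ - sⱼ) + E ∑ (φ̃ᵢ - τ̃ⱼ) = E ∑ (φ̃ᵢ - sⱼ) + E ∑ (bᵢ - τ̃ⱼ)`.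
The two terms are at most the expected maxima attained by GSOM and GBOM (`Mechanism.GFT_le`), which
in turn are at most their gains from trade, because `φ̃ᵢ ≤ bᵢ` and `sⱼ ≤ τ̃ⱼ`.

*Budget.* In GSOM the buyers pay exactly their virtual values in expectation, while a seller's
threshold gain is at most the virtual value of her partner: otherwise removing that pair would
improve the matching at the threshold (`Market.threshold_le_virtualValue`). So GSOM runs no deficit;
GBOM is symmetric. Both are truthful at every profile, since the allocation is monotone.

*Strong budget balance.* As types are independent and every factor of the product in the balancing
payments has mean one, the transformation preserves all interim payments, hence IR and BIC; ex-ante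
balance becomes balance at every profile (`Mechanism.sbbTransform_spec`).
-/

namespace DoubleAuction

/-! ### Concave envelopes of finite point sets -/

section Envelope

variable {ι : Type*} {x y : ι → ℝ}

/-- The upper concave envelope of the finitely many points `(x r, y r)`, evaluated at the abscissa
`x t` of one of them. In the plane, convex combinations of two points suffice. -/
noncomputable def concaveEnvelope (x y : ι → ℝ) (t : ι) : ℝ :=
  sSup {z | ∃ t₁ t₂ : ι, ∃ δ ∈ Set.Icc (0 : ℝ) 1,
    x t = δ * x t₁ + (1 - δ) * x t₂ ∧ z = δ * y t₁ + (1 - δ) * y t₂}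

/-- A line above all the points is above their envelope. -/
theorem concaveEnvelope_le_of_line {a k : ℝ} (h : ∀ r, y r ≤ a + k * x r) (t : ι) :
    concaveEnvelope x y t ≤ a + k * x t := by
  refine csSup_le ⟨y t, t, t, 1, by simp, by simp, by simp⟩ ?_
  rintro z ⟨t₁, t₂, δ, ⟨h0, h1⟩, hx, rfl⟩
  have e1 := mul_le_mul_of_nonneg_left (h t₁) h0
  have e2 := mul_le_mul_of_nonneg_left (h t₂) (sub_nonneg.2 h1)
  rw [hx]
  linarith

variable [Fintype ι]

theorem concaveEnvelope_lt_of_line {a k : ℝ} (h : ∀ r, y r < a + k * x r) (t : ι) :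
    concaveEnvelope x y t < a + k * x t := by
  obtain ⟨r, -, hr⟩ := Finset.univ.exists_max_image (fun r => y r - k * x r) ⟨t, Finset.mem_univ t⟩
  have h1 : concaveEnvelope x y t ≤ (y r - k * x r) + k * x t :=
    concaveEnvelope_le_of_line (fun u => by have := hr u (Finset.mem_univ u); linarith) t
  linarith [h r]

theorem chord_le_concaveEnvelope {t t₁ t₂ : ι} {δ : ℝ} (hδ : δ ∈ Set.Icc (0 : ℝ) 1)
    (hx : x t = δ * x t₁ + (1 - δ) * x t₂) :
    δ * y t₁ + (1 - δ) * y t₂ ≤ concaveEnvelope x y t := by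
  refine le_csSup ?_ ⟨t₁, t₂, δ, hδ, hx, rfl⟩
  obtain ⟨r, -, hr⟩ := Finset.univ.exists_max_image y ⟨t, Finset.mem_univ t⟩
  refine ⟨y r, ?_⟩
  rintro z ⟨u₁, u₂, ε, ⟨h0, h1⟩, -, rfl⟩
  have e1 := mul_le_mul_of_nonneg_left (hr u₁ (Finset.mem_univ _)) h0
  have e2 := mul_le_mul_of_nonneg_left (hr u₂ (Finset.mem_univ _)) (sub_nonneg.2 h1)
  linarith

theorem le_concaveEnvelope (t : ι) : y t ≤ concaveEnvelope x y t := by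
  have := chord_le_concaveEnvelope (x := x) (y := y) (t := t) (t₁ := t) (t₂ := t) (δ := 1)
    (by simp) (by simp)
  simpa using this

/-- The envelope has a supporting line at each of the points: every slope to the right of `t` is
at most every slope to the left of it, as otherwise a chord would pass above the envelope. -/
theorem exists_supporting_slope (t : ι) :
    ∃ k, ∀ r, y r ≤ concaveEnvelope x y t + k * (x r - x t) := by
  set E := concaveEnvelope x y t with hE
  have key : ∀ r u, x r < x t → x t < x u → (y u - E) / (x u - x t) ≤ (E - y r) / (x t - x r) := by
    intro r u hr hu
    have hr' : 0 < x t - x r := sub_pos.2 hr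
    have hu' : 0 < x u - x t := sub_pos.2 hu
    have hru : 0 < x u - x r := by linarith
    have h := chord_le_concaveEnvelope (x := x) (y := y) (t := t) (t₁ := r) (t₂ := u)
      (δ := (x u - x t) / (x u - x r))
      ⟨by positivity, by rw [div_le_one hru]; linarith⟩ (by field_simp; ring)
    rw [← hE] at h
    have h2 : (x u - x t) * y r + (x t - x r) * y u ≤ E * (x u - x r) := by
      have := mul_le_mul_of_nonneg_right h hru.le
      have e : ((x u - x t) / (x u - x r) * y r + (1 - (x u - x t) / (x u - x r)) * y u)
          * (x u - x r) = (x u - x t) * y r + (x t - x r) * y u := by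
        field_simp; ring
      rwa [e] at this
    rw [div_le_div_iff₀ hu' hr']
    nlinarith
  have hflat : ∀ r, x r = x t → y r ≤ E := by
    intro r hr
    have := chord_le_concaveEnvelope (x := x) (y := y) (t := t) (t₁ := r) (t₂ := r) (δ := 1)
      (by simp) (by simp [hr])
    simpa using this
  -- the largest slope to the right of `t` works; if there is none, the smallest one to the left
  by_cases hR : (Finset.univ.filter fun u => x t < x u).Nonempty
  · obtain ⟨u, hu, hmax⟩ := Finset.exists_max_image _ (fun u => (y u - E) / (x u - x t)) hR
    refine ⟨(y u - E) / (x u - x t), fun r => ?_⟩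
    rcases lt_trichotomy (x r) (x t) with h | h | h
    · have := key r u h (Finset.mem_filter.1 hu).2
      rw [le_div_iff₀ (sub_pos.2 h)] at this
      linarith
    · rw [h]; simpa using hflat r h
    · have := hmax r (Finset.mem_filter.2 ⟨Finset.mem_univ _, h⟩)
      rw [div_le_iff₀ (sub_pos.2 h)] at this
      linarith
  · have hR' : ∀ r, x r ≤ x t := fun r => by
      by_contra h
      exact hR ⟨r, Finset.mem_filter.2 ⟨Finset.mem_univ _, not_le.1 h⟩⟩
    by_cases hL : (Finset.univ.filter fun u => x u < x t).Nonempty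
    · obtain ⟨u, hu, hmin⟩ := Finset.exists_min_image _ (fun u => (E - y u) / (x t - x u)) hL
      refine ⟨(E - y u) / (x t - x u), fun r => ?_⟩
      rcases (hR' r).lt_or_eq with h | h
      · have := hmin r (Finset.mem_filter.2 ⟨Finset.mem_univ _, h⟩)
        rw [le_div_iff₀ (sub_pos.2 h)] at this
        linarith
      · rw [h]; simpa using hflat r h
    · refine ⟨0, fun r => ?_⟩
      rcases (hR' r).lt_or_eq with h | h
      · exact absurd ⟨r, Finset.mem_filter.2 ⟨Finset.mem_univ _, h⟩⟩ hL
      · simpa using hflat r h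

/-- A supporting line at `t` bounds the envelope, not only the points. -/
theorem exists_supporting_slope_concaveEnvelope (t : ι) :
    ∃ k, ∀ r, y r ≤ concaveEnvelope x y t + k * (x r - x t) ∧
      concaveEnvelope x y r ≤ concaveEnvelope x y t + k * (x r - x t) := by
  obtain ⟨k, hk⟩ := exists_supporting_slope (x := x) (y := y) t
  refine ⟨k, fun r => ⟨hk r, ?_⟩⟩
  have := concaveEnvelope_le_of_line (x := x) (y := y) (a := concaveEnvelope x y t - k * x t)
    (k := k) (fun r => by linarith [hk r]) r
  linarith

/-- At an extreme abscissa the envelope passes through the point. -/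
theorem concaveEnvelope_eq_of_extreme (hx : Function.Injective x) (t : ι)
    (h : (∀ r, x t ≤ x r) ∨ (∀ r, x r ≤ x t)) : concaveEnvelope x y t = y t := by
  refine le_antisymm (csSup_le ⟨y t, t, t, 1, by simp, by simp, by simp⟩ ?_) (le_concaveEnvelope t)
  rintro z ⟨t₁, t₂, δ, ⟨h0, h1⟩, he, rfl⟩
  have h1' : 0 ≤ 1 - δ := sub_nonneg.2 h1
  have hz : δ * (x t₁ - x t) = 0 ∧ (1 - δ) * (x t₂ - x t) = 0 := by
    rcases h with h | h
    · have a := mul_nonneg h0 (sub_nonneg.2 (h t₁))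
      have b := mul_nonneg h1' (sub_nonneg.2 (h t₂))
      constructor <;> linarith
    · have a := mul_nonneg h0 (sub_nonneg.2 (h t₁))
      have b := mul_nonneg h1' (sub_nonneg.2 (h t₂))
      constructor <;> linarith
  have aux : ∀ (c : ℝ) (u : ι), c * (x u - x t) = 0 → c * y u = c * y t := by
    intro c u hc
    rcases mul_eq_zero.1 hc with hc | hc
    · simp [hc]
    · rw [hx (sub_eq_zero.1 hc)]
  rw [aux _ _ hz.1, aux _ _ hz.2]
  linarith

end Envelope

/-! ### Summation by parts on a finite linear order -/

section Abel

variable {ι : Type*} [Fintype ι] [LinearOrder ι]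

open Classical in
/-- The increment of `x` at `t` over its predecessor, where `x` is taken to be `0` below the
smallest element. -/
noncomputable def jump (x : ι → ℝ) (t : ι) : ℝ :=
  if h : ∃ r, r ⋖ t then x t - x h.choose else x t

theorem jump_of_covBy (x : ι → ℝ) {r t : ι} (h : r ⋖ t) : jump x t = x t - x r := by
  have hex : ∃ r, r ⋖ t := ⟨r, h⟩
  rw [jump, dif_pos hex, hex.choose_spec.unique_left h]

theorem jump_of_isMin (x : ι → ℝ) {t : ι} (h : IsMin t) : jump x t = x t := by
  rw [jump, dif_neg]
  rintro ⟨r, hr⟩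
  exact h.not_lt hr.lt

theorem sum_le_jump (x : ι → ℝ) (t : ι) : ∑ r with r ≤ t, jump x r = x t := by
  induction t using WellFoundedLT.induction with
  | ind t ih =>
    by_cases h : IsMin t
    · have : Finset.univ.filter (fun r => r ≤ t) = {t} := by
        ext r
        simpa using ⟨fun hr => h.eq_of_le hr, fun hr => hr.le⟩
      rw [this, Finset.sum_singleton, jump_of_isMin x h]
    · obtain ⟨u, hu⟩ := exists_covBy_of_wellFoundedGT h
      have : Finset.univ.filter (fun r => r ≤ t)
          = insert t (Finset.univ.filter fun r => r ≤ u) := by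
        ext r
        simp only [Finset.mem_filter, Finset.mem_univ, true_and, Finset.mem_insert]
        rw [le_iff_eq_or_lt, hu.lt_iff_le_left]
      rw [this, Finset.sum_insert (by simpa using hu.lt), ih u hu.lt, jump_of_covBy x hu]
      ring

theorem sum_mul_eq_sum_jump (g x : ι → ℝ) :
    ∑ t, g t * x t = ∑ r, jump x r * ∑ t with r ≤ t, g t := by
  simp_rw [Finset.mul_sum]
  calc ∑ t, g t * x t = ∑ t, ∑ r with r ≤ t, jump x r * g t := by
        refine Finset.sum_congr rfl fun t _ => ?_
        rw [← Finset.sum_mul, sum_le_jump, mul_comm]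
    _ = _ := Finset.sum_comm' (by simp)

end Abel

/-! ### Ironed virtual values of a single agent -/

section Ironing

variable {ι : Type*} [Fintype ι] [LinearOrder ι]

/-- The total weight of the types `≥ t`. -/
noncomputable def upperTail (f : ι → ℝ) (t : ι) : ℝ := ∑ r with t ≤ r, f r

/-- The ironed revenue curve of an agent with values `v` and type weights `f`. -/
noncomputable def ironedCurve (v f : ι → ℝ) : ι → ℝ :=
  concaveEnvelope (upperTail f) fun t => v t * upperTail f t

/-- `φ` is the ironed virtual value of an agent whose types are the elements of `ι`, with values `v`
and weights `f`. A buyer's types are ordered by value; a seller is a buyer with values `-s`,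
whose types come in the reverse order. `slope` is the chord slope of the ironed curve between
neighbouring types, cleared of its denominator `f t`, the difference of the two tails. -/
structure IsIroned (v f φ : ι → ℝ) : Prop where
  strictMono : StrictMono v
  pos : ∀ t, 0 < f t
  top : ∀ t, IsMax t → φ t = v t
  slope : ∀ t u, t ⋖ u → f t * φ t = ironedCurve v f t - ironedCurve v f u

theorem upperTail_covBy (f : ι → ℝ) {t u : ι} (h : t ⋖ u) :
    upperTail f t = f t + upperTail f u := by
  have : Finset.univ.filter (fun r => t ≤ r) = insert t (Finset.univ.filter fun r => u ≤ r) := by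
    ext r
    simp only [Finset.mem_filter, Finset.mem_univ, true_and, Finset.mem_insert]
    rw [le_iff_eq_or_lt, h.lt_iff_le_right, eq_comm]
  rw [upperTail, this, Finset.sum_insert (by simpa using h.lt), upperTail]

theorem upperTail_isMax (f : ι → ℝ) {t : ι} (h : IsMax t) : upperTail f t = f t := by
  have : Finset.univ.filter (fun r => t ≤ r) = {t} := by
    ext r
    simpa using ⟨fun hr => (h.eq_of_le hr).symm, fun hr => hr.ge⟩
  rw [upperTail, this, Finset.sum_singleton]

namespace IsIroned

variable {v f φ : ι → ℝ}

theorem strictAnti_upperTail (h : IsIroned v f φ) : StrictAnti (upperTail f) := by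
  intro t u htu
  refine Finset.sum_lt_sum_of_subset (i := t) ?_ (by simp) (by simpa using htu) (h.pos t)
    fun r _ _ => (h.pos r).le
  intro r
  simpa using fun hr => htu.le.trans hr

theorem le_ironedCurve (t : ι) : v t * upperTail f t ≤ ironedCurve v f t :=
  le_concaveEnvelope (y := fun t => v t * upperTail f t) t

theorem ironedCurve_isMax (h : IsIroned v f φ) {t : ι} (ht : IsMax t) :
    ironedCurve v f t = v t * upperTail f t :=
  concaveEnvelope_eq_of_extreme h.strictAnti_upperTail.injective t
    (Or.inl fun r => h.strictAnti_upperTail.antitone (ht.isTop r))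

theorem ironedCurve_isMin (h : IsIroned v f φ) {t : ι} (ht : IsMin t) :
    ironedCurve v f t = v t * upperTail f t :=
  concaveEnvelope_eq_of_extreme h.strictAnti_upperTail.injective t
    (Or.inr fun r => h.strictAnti_upperTail.antitone (ht.isBot r))

/-- The ironed revenue curve is recovered from the ironed virtual value by summing slopes. -/
theorem sum_upper (h : IsIroned v f φ) (t : ι) :
    ∑ r with t ≤ r, f r * φ r = ironedCurve v f t := by
  change upperTail (fun r => f r * φ r) t = _
  induction t using WellFoundedGT.induction with
  | ind t ih =>
    by_cases ht : IsMax t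
    · rw [upperTail_isMax _ ht, h.ironedCurve_isMax ht, h.top t ht, upperTail_isMax f ht, mul_comm]
    · obtain ⟨u, hu⟩ := exists_covBy_of_wellFoundedLT ht
      rw [upperTail_covBy _ hu, ih u hu.lt, h.slope t u hu]
      ring

/-- Ironed virtual values do not exceed values: if a supporting line at the successor `u` of `t` is
steeper than `v t`, tilting it to the slope `v t` keeps it above all points. -/
theorem le_value (h : IsIroned v f φ) (t : ι) : φ t ≤ v t := by
  by_cases ht : IsMax t
  · exact (h.top t ht).le
  obtain ⟨u, hu⟩ := exists_covBy_of_wellFoundedLT ht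
  have hf := h.pos t
  have hQ := upperTail_covBy f hu
  have hs := h.slope t u hu
  suffices ironedCurve v f t ≤ ironedCurve v f u + v t * f t by
    refine le_of_mul_le_mul_left (a := f t) ?_ hf
    rw [hs]
    linarith
  obtain ⟨k, hk⟩ := exists_supporting_slope_concaveEnvelope (x := upperTail f)
    (y := fun t => v t * upperTail f t) u
  change ∀ r, _ ≤ ironedCurve v f u + _ ∧ ironedCurve v f r ≤ ironedCurve v f u + _ at hk
  rcases le_total k (v t) with hkt | hkt
  · have h1 := (hk t).2
    have h2 := mul_le_mul_of_nonneg_right hkt hf.le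
    rw [hQ] at h1
    linarith
  · have := concaveEnvelope_le_of_line (x := upperTail f) (y := fun t => v t * upperTail f t)
      (a := ironedCurve v f u - v t * upperTail f u) (k := v t) ?_ t
    · change ironedCurve v f t ≤ _ at this
      rw [hQ] at this
      linarith
    intro r
    rcases le_or_gt r t with hr | hr
    · have hr0 : 0 ≤ upperTail f r := Finset.sum_nonneg fun i _ => (h.pos i).le
      have hu0 : 0 ≤ upperTail f u := Finset.sum_nonneg fun i _ => (h.pos i).le
      have h1 := mul_le_mul_of_nonneg_right (h.strictMono.monotone hr) hr0
      have h2 := mul_le_mul_of_nonneg_right (h.strictMono hu.lt).le hu0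
      have h3 := le_ironedCurve (v := v) (f := f) u
      linarith
    · have h1 := (hk r).1
      have h2 := h.strictAnti_upperTail.antitone (hu.lt_iff_le_right.1 hr)
      have h3 := mul_le_mul_of_nonneg_right hkt (sub_nonneg.2 h2)
      linarith

/-- Every supporting line at the upper end `u` of an edge is at least as steep as the edge: larger
types have smaller abscissae, so the edge between `t` and `u` lies to the right of `u`. -/
theorem exists_slope_ge (h : IsIroned v f φ) {t u : ι} (htu : t ⋖ u) :
    ∃ k, φ t ≤ k ∧ ∀ r, v r * upperTail f r ≤
      ironedCurve v f u + k * (upperTail f r - upperTail f u) ∧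
      ironedCurve v f r ≤ ironedCurve v f u + k * (upperTail f r - upperTail f u) := by
  obtain ⟨k, hk⟩ := exists_supporting_slope_concaveEnvelope (x := upperTail f)
    (y := fun t => v t * upperTail f t) u
  refine ⟨k, ?_, hk⟩
  have h1 : ironedCurve v f t ≤ _ := (hk t).2
  change _ ≤ ironedCurve v f u + _ at h1
  rw [upperTail_covBy f htu] at h1
  refine le_of_mul_le_mul_left (a := f t) ?_ (h.pos t)
  rw [h.slope t u htu]
  linarith

/-- Every supporting line at the lower end `t` of an edge is at most as steep as the edge. -/
theorem exists_slope_le (h : IsIroned v f φ) {t u : ι} (htu : t ⋖ u) :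
    ∃ k, k ≤ φ t ∧ ∀ r, v r * upperTail f r ≤
      ironedCurve v f t + k * (upperTail f r - upperTail f t) ∧
      ironedCurve v f r ≤ ironedCurve v f t + k * (upperTail f r - upperTail f t) := by
  obtain ⟨k, hk⟩ := exists_supporting_slope_concaveEnvelope (x := upperTail f)
    (y := fun t => v t * upperTail f t) t
  refine ⟨k, ?_, hk⟩
  have h1 : ironedCurve v f u ≤ _ := (hk u).2
  change _ ≤ ironedCurve v f t + _ at h1
  rw [upperTail_covBy f htu] at h1
  refine le_of_mul_le_mul_left (a := f t) ?_ (h.pos t)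
  rw [h.slope t u htu]
  linarith

theorem monotone (h : IsIroned v f φ) : Monotone φ := by
  classical
  let _ : LocallyFiniteOrder ι := Fintype.toLocallyFiniteOrder
  rw [monotone_iff_forall_covBy]
  intro t u htu
  by_cases hu : IsMax u
  · rw [h.top u hu]
    exact (h.le_value t).trans (h.strictMono htu.lt).le
  · obtain ⟨w, hw⟩ := exists_covBy_of_wellFoundedLT hu
    obtain ⟨k, h1, hk⟩ := h.exists_slope_ge htu
    refine h1.trans ?_
    have h2 := (hk w).2
    rw [upperTail_covBy f hw] at h2
    refine le_of_mul_le_mul_left (a := f u) ?_ (h.pos u)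
    rw [h.slope u w hw]
    linarith

/-- Where the ironed virtual value jumps, the ironed revenue curve has a strict vertex, so it agrees
with the revenue curve there. -/
theorem ironedCurve_eq_of_lt (h : IsIroned v f φ) {t u : ι} (htu : t ⋖ u) (hlt : φ t < φ u) :
    ironedCurve v f u = v u * upperTail f u := by
  by_cases hu : IsMax u
  · exact h.ironedCurve_isMax hu
  obtain ⟨w, hw⟩ := exists_covBy_of_wellFoundedLT hu
  refine le_antisymm (not_lt.1 fun hcon => ?_) (le_ironedCurve u)
  obtain ⟨k₁, hk₁, hL⟩ := h.exists_slope_le htu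
  obtain ⟨k₂, hk₂, hR⟩ := h.exists_slope_ge hw
  have hanti := h.strictAnti_upperTail
  have e1 := h.slope t u htu
  have e2 := h.slope u w hw
  have q1 := upperTail_covBy f htu
  have q2 := upperTail_covBy f hw
  -- a line through the vertex with a slope strictly between those of the adjacent edges
  obtain ⟨k, hk1, hk2⟩ := exists_between hlt
  have := concaveEnvelope_lt_of_line (x := upperTail f) (y := fun t => v t * upperTail f t)
    (a := ironedCurve v f u - k * upperTail f u) (k := k) ?_ u
  · change ironedCurve v f u < _ at this
    linarith
  intro r
  rcases lt_trichotomy r u with hr | rfl | hr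
  · have a1 := (hL r).1
    have a2 : upperTail f t ≤ upperTail f r := hanti.antitone (htu.lt_iff_le_left.1 hr)
    have a3 := mul_le_mul_of_nonneg_right hk₁ (sub_nonneg.2 a2)
    have a4 := mul_lt_mul_of_pos_right hk1 (sub_pos.2 (hanti hr))
    rw [q1] at a1 a2 a3
    linarith
  · linarith
  · have a1 := (hR r).1
    have a2 : upperTail f r ≤ upperTail f w := hanti.antitone (hw.lt_iff_le_right.1 hr)
    have a3 := mul_le_mul_of_nonneg_right hk₂ (sub_nonneg.2 a2)
    have a4 := mul_lt_mul_of_pos_right hk2 (sub_pos.2 (hanti hr))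
    have q3 : φ u * upperTail f u = φ u * (f u + upperTail f w) := by rw [← q2]
    linarith

/-- **Myerson's bound**: under interim incentive compatibility and individual rationality, the
expected payment is at most the expected ironed virtual value of the allocation. -/
theorem payment_le (h : IsIroned v f φ) {x p : ι → ℝ} (hx0 : ∀ t, 0 ≤ x t)
    (ic : ∀ t u, v t * x u - p u ≤ v t * x t - p t) (ir : ∀ t, 0 ≤ v t * x t - p t) :
    ∑ t, f t * p t ≤ ∑ t, f t * (φ t * x t) := by
  have hmono : Monotone x := by
    intro t u htu
    rcases htu.eq_or_lt with rfl | hlt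
    · exact le_rfl
    have a := ic t u
    have b := ic u t
    have c := h.strictMono hlt
    nlinarith
  simp_rw [← mul_assoc]
  rw [sum_mul_eq_sum_jump f p, sum_mul_eq_sum_jump _ x]
  -- compare increments: not misreporting the predecessor of `t` bounds the rise of the payment at `t`
  -- by `v t` times the rise of the allocation
  refine Finset.sum_le_sum fun t _ => ?_
  have hQ : 0 ≤ upperTail f t := Finset.sum_nonneg fun i _ => (h.pos i).le
  rw [h.sum_upper]
  change jump p t * upperTail f t ≤ _
  obtain ⟨h1, h2⟩ : jump p t ≤ v t * jump x t ∧ 0 ≤ jump x t := by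
    by_cases ht : IsMin t
    · rw [jump_of_isMin _ ht, jump_of_isMin _ ht]
      exact ⟨by linarith [ir t], hx0 t⟩
    · obtain ⟨r, hr⟩ := exists_covBy_of_wellFoundedGT ht
      rw [jump_of_covBy _ hr, jump_of_covBy _ hr]
      exact ⟨by linarith [ic t r], sub_nonneg.2 (hmono hr.le)⟩
  calc jump p t * upperTail f t ≤ v t * jump x t * upperTail f t :=
        mul_le_mul_of_nonneg_right h1 hQ
    _ = jump x t * (v t * upperTail f t) := by ring
    _ ≤ _ := mul_le_mul_of_nonneg_left (le_ironedCurve t) h2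

/-- **Revenue equality for posted prices**: if the set of winning types is upward closed and does
not separate types of equal ironed virtual value, then charging the smallest winning value extracts
exactly the ironed virtual value of the allocation. -/
theorem threshold_revenue (h : IsIroned v f φ) {P : ι → Prop} [DecidablePred P] {θ : ι}
    (hθ : P θ) (hmin : ∀ t, P t → θ ≤ t) (hup : ∀ t u, t ≤ u → P t → P u)
    (hφ : ∀ t u, φ t = φ u → P t → P u) :
    ∑ t, f t * (if P t then v θ else 0) = ∑ t, f t * (φ t * if P t then 1 else 0) := by
  have hP : ∀ t, P t ↔ θ ≤ t := fun t => ⟨hmin t, fun ht => hup θ t ht hθ⟩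
  have h1 : ∑ t, f t * (if P t then v θ else 0) = v θ * upperTail f θ := by
    rw [upperTail, Finset.mul_sum, Finset.sum_filter]
    refine Finset.sum_congr rfl fun t _ => ?_
    simp only [hP]
    split_ifs <;> ring
  have h2 : ∑ t, f t * (φ t * if P t then 1 else 0) = ironedCurve v f θ := by
    rw [← h.sum_upper, Finset.sum_filter]
    refine Finset.sum_congr rfl fun t _ => ?_
    simp only [hP]
    split_ifs <;> ring
  rw [h1, h2]
  by_cases hm : IsMin θ
  · exact (h.ironedCurve_isMin hm).symm
  · obtain ⟨r, hr⟩ := exists_covBy_of_wellFoundedGT hm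
    refine (h.ironedCurve_eq_of_lt hr ((h.monotone hr.le).lt_of_ne fun he => ?_)).symm
    exact hr.lt.not_ge (hmin r (hφ θ r he.symm hθ))

end IsIroned

end Ironing

/-! ### Buyers and sellers as instances of the single-agent theory -/

namespace ValueDist

variable (d : ValueDist)

theorem upperTail_coe (t : d.supp) :
    upperTail (fun r : d.supp => d.mass r) t = d.tail t := by
  rw [upperTail, tail, Finset.sum_filter, Finset.sum_filter, ← Finset.sum_coe_sort d.supp]
  rfl

theorem ironedCurve_coe (t : d.supp) :
    ironedCurve (fun r : d.supp => (r : ℝ)) (fun r : d.supp => d.mass r) t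
      = d.ironedRevenue t := by
  simp only [ironedCurve, concaveEnvelope, ironedRevenue, upperTail_coe, revenue, Subtype.exists,
    exists_prop]

theorem isIroned_ironedPhi :
    IsIroned (fun t : d.supp => (t : ℝ)) (fun t => d.mass t) (fun t => d.ironedPhi t) where
  strictMono _ _ h := h
  pos t := d.mass_pos t t.2
  top t ht := by
    refine dif_neg ?_
    rintro ⟨r, hr⟩
    obtain ⟨hr, htr⟩ := Finset.mem_filter.1 hr
    exact ht.not_lt (b := ⟨r, hr⟩) htr
  slope t u htu := by
    have hmem : (u : ℝ) ∈ d.supp.filter fun r => (t : ℝ) < r := Finset.mem_filter.2 ⟨u.2, htu.lt⟩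
    have hmin : (d.supp.filter fun r => (t : ℝ) < r).min' ⟨u, hmem⟩ = u := by
      refine le_antisymm (Finset.min'_le _ _ hmem) (Finset.le_min' _ _ _ fun r hr => ?_)
      obtain ⟨hr, htr⟩ := Finset.mem_filter.1 hr
      exact htu.lt_iff_le_right.1 (show t < ⟨r, hr⟩ from htr)
    have hQ := upperTail_covBy (fun r : d.supp => d.mass r) htu
    rw [ironedCurve_coe, ironedCurve_coe, ironedPhi, dif_pos ⟨(u : ℝ), hmem⟩]
    simp only [hmin]
    rw [upperTail_coe, upperTail_coe] at hQ
    have : d.tail t - d.tail u = d.mass t := by linarith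
    rw [this, mul_div_cancel₀ _ (d.mass_pos t t.2).ne']

/-- The value of a seller's type, the types being put in reverse order. -/
abbrev dualVal (t : (d.supp)ᵒᵈ) : ℝ := (OrderDual.ofDual t : d.supp)

theorem upperTail_dual (t : d.suppᵒᵈ) :
    upperTail (fun r : (d.supp)ᵒᵈ => d.mass (d.dualVal r)) t
      = d.cdf (d.dualVal t) := by
  rw [upperTail, cdf, Finset.sum_filter, Finset.sum_filter, ← Finset.sum_coe_sort d.supp]
  rfl

theorem ironedCurve_dual (t : d.suppᵒᵈ) :
    ironedCurve (fun r : (d.supp)ᵒᵈ => -d.dualVal r)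
      (fun r => d.mass (d.dualVal r)) t = -d.ironedCost (d.dualVal t) := by
  rw [ironedCost, Real.sInf_def, neg_neg, ironedCurve, concaveEnvelope]
  congr 1
  ext z
  simp only [upperTail_dual, Set.mem_ofPred_eq, Set.mem_neg, cost]
  constructor
  · rintro ⟨t₁, t₂, δ, hδ, hx, rfl⟩
    exact ⟨_, (OrderDual.ofDual t₁).2, _, (OrderDual.ofDual t₂).2, δ, hδ, hx, by ring⟩
  · rintro ⟨t₁, h₁, t₂, h₂, δ, hδ, hx, hz⟩
    refine ⟨OrderDual.toDual ⟨t₁, h₁⟩, OrderDual.toDual ⟨t₂, h₂⟩, δ, hδ, hx, ?_⟩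
    change z = δ * (-t₁ * d.cdf t₁) + (1 - δ) * (-t₂ * d.cdf t₂)
    linarith

theorem isIroned_ironedTau :
    IsIroned (fun t : (d.supp)ᵒᵈ => -d.dualVal t)
      (fun t => d.mass (d.dualVal t)) (fun t => -d.ironedTau (d.dualVal t)) where
  strictMono _ _ h := neg_lt_neg (show _ from h)
  pos t := d.mass_pos _ (OrderDual.ofDual t).2
  top t ht := by
    refine congrArg Neg.neg (dif_neg ?_)
    rintro ⟨r, hr⟩
    obtain ⟨hr, htr⟩ := Finset.mem_filter.1 hr
    exact ht.not_lt (b := OrderDual.toDual ⟨r, hr⟩) htr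
  slope t u htu := by
    have hmem : d.dualVal u ∈ d.supp.filter fun r => r < d.dualVal t :=
      Finset.mem_filter.2 ⟨(OrderDual.ofDual u).2, htu.lt⟩
    have hmax : (d.supp.filter fun r => r < d.dualVal t).max' ⟨_, hmem⟩
        = d.dualVal u := by
      refine le_antisymm (Finset.max'_le _ _ _ fun r hr => ?_) (Finset.le_max' _ _ hmem)
      obtain ⟨hr, htr⟩ := Finset.mem_filter.1 hr
      exact htu.lt_iff_le_right.1 (show t < OrderDual.toDual ⟨r, hr⟩ from htr)
    have hQ := upperTail_covBy (fun r : (d.supp)ᵒᵈ => d.mass (d.dualVal r)) htu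
    rw [ironedCurve_dual, ironedCurve_dual, ironedTau, dif_pos ⟨_, hmem⟩]
    simp only [hmax]
    rw [upperTail_dual, upperTail_dual] at hQ
    have : d.cdf (d.dualVal t) - d.cdf (d.dualVal u)
      = d.mass (d.dualVal t) := by linarith
    rw [this, mul_neg, mul_div_cancel₀ _ (d.mass_pos _ (OrderDual.ofDual t).2).ne']
    ring

theorem ironedPhi_le (t : d.supp) : d.ironedPhi t ≤ t := d.isIroned_ironedPhi.le_value t

theorem le_ironedTau (t : d.supp) : (t : ℝ) ≤ d.ironedTau t :=
  neg_le_neg_iff.1 (d.isIroned_ironedTau.le_value (OrderDual.toDual t))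

theorem monotone_ironedPhi : Monotone fun t : d.supp => d.ironedPhi t :=
  d.isIroned_ironedPhi.monotone

theorem monotone_ironedTau : Monotone fun t : d.supp => d.ironedTau t := fun a b hab =>
  neg_le_neg_iff.1 (d.isIroned_ironedTau.monotone (a := OrderDual.toDual b)
    (b := OrderDual.toDual a) hab)

/-- Myerson's bound on a buyer's expected payment. -/
theorem buyer_payment_le {x p : d.supp → ℝ} (hx0 : ∀ t, 0 ≤ x t)
    (ic : ∀ t u, t * x u - p u ≤ t * x t - p t) (ir : ∀ t : d.supp, 0 ≤ t * x t - p t) :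
    ∑ t : d.supp, d.mass t * p t ≤ ∑ t : d.supp, d.mass t * (d.ironedPhi t * x t) :=
  d.isIroned_ironedPhi.payment_le hx0 ic ir

/-- Myerson's bound on a seller's expected gain. -/
theorem le_seller_gain {x p : d.supp → ℝ} (hx0 : ∀ t, 0 ≤ x t)
    (ic : ∀ t u, p u - t * x u ≤ p t - t * x t) (ir : ∀ t : d.supp, 0 ≤ p t - t * x t) :
    ∑ t : d.supp, d.mass t * (d.ironedTau t * x t) ≤ ∑ t : d.supp, d.mass t * p t := by
  have h := d.isIroned_ironedTau.payment_le (x := fun t => x (OrderDual.ofDual t))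
    (p := fun t => -p (OrderDual.ofDual t)) (fun t => hx0 _)
    (fun t u => by linarith [ic (OrderDual.ofDual t) (OrderDual.ofDual u)])
    (fun t => by linarith [ir (OrderDual.ofDual t)])
  simp only [mul_neg, neg_mul, Finset.sum_neg_distrib, neg_le_neg_iff] at h
  exact h

/-- The smallest value of a winning type, `P` being the set of winning types. -/
noncomputable abbrev lowestWinning (P : d.supp → Prop) : ℝ :=
  sInf {v : ℝ | ∃ t : d.supp, (t : ℝ) = v ∧ P t}

/-- The largest value of a winning type. -/
noncomputable abbrev highestWinning (P : d.supp → Prop) : ℝ :=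
  sSup {v : ℝ | ∃ t : d.supp, (t : ℝ) = v ∧ P t}

variable {d}

/-- The infimum in a buyer's threshold price is attained. -/
theorem exists_threshold_buyer {P : d.supp → Prop} (hP : ∃ t, P t) :
    ∃ θ : d.supp, P θ ∧ (∀ t, P t → θ ≤ t) ∧ d.lowestWinning P = θ := by
  classical
  obtain ⟨t, ht⟩ := hP
  obtain ⟨θ, hθ, hmin⟩ := (Finset.univ.filter P).exists_min_image id ⟨t, by simpa using ht⟩
  simp only [Finset.mem_filter, Finset.mem_univ, true_and, id] at hθ hmin
  refine ⟨θ, hθ, hmin, IsLeast.csInf_eq ⟨⟨θ, rfl, hθ⟩, ?_⟩⟩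
  rintro _ ⟨t, rfl, ht⟩
  exact hmin t ht

/-- The supremum in a seller's threshold gain is attained. -/
theorem exists_threshold_seller {P : d.supp → Prop} (hP : ∃ t, P t) :
    ∃ θ : d.supp, P θ ∧ (∀ t, P t → t ≤ θ) ∧ d.highestWinning P = θ := by
  classical
  obtain ⟨t, ht⟩ := hP
  obtain ⟨θ, hθ, hmax⟩ := (Finset.univ.filter P).exists_max_image id ⟨t, by simpa using ht⟩
  simp only [Finset.mem_filter, Finset.mem_univ, true_and, id] at hθ hmax
  refine ⟨θ, hθ, hmax, IsGreatest.csSup_eq ⟨⟨θ, rfl, hθ⟩, ?_⟩⟩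
  rintro _ ⟨t, rfl, ht⟩
  exact hmax t ht

theorem buyer_threshold_revenue {P : d.supp → Prop} [DecidablePred P]
    (hup : ∀ t u, t ≤ u → P t → P u)
    (hφ : ∀ t u : d.supp, d.ironedPhi t = d.ironedPhi u → P t → P u) :
    ∑ t : d.supp, d.mass t * (if P t then d.lowestWinning P else 0)
      = ∑ t : d.supp, d.mass t * (d.ironedPhi t * if P t then 1 else 0) := by
  by_cases hP : ∃ t, P t
  · obtain ⟨θ, hθ, hmin, he⟩ := exists_threshold_buyer hP
    rw [he]
    exact d.isIroned_ironedPhi.threshold_revenue hθ hmin hup hφ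
  · push Not at hP
    simp [hP]

theorem seller_threshold_gain {P : d.supp → Prop} [DecidablePred P]
    (hdown : ∀ t u, t ≤ u → P u → P t)
    (hτ : ∀ t u : d.supp, d.ironedTau t = d.ironedTau u → P t → P u) :
    ∑ t : d.supp, d.mass t * (if P t then d.highestWinning P else 0)
      = ∑ t : d.supp, d.mass t * (d.ironedTau t * if P t then 1 else 0) := by
  by_cases hP : ∃ t, P t
  · obtain ⟨θ, hθ, hmax, he⟩ := exists_threshold_seller hP
    rw [he]
    have h := d.isIroned_ironedTau.threshold_revenue (P := fun t => P (OrderDual.ofDual t))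
      (θ := OrderDual.toDual θ) hθ (fun t ht => hmax _ ht) (fun t u htu ht => hdown _ _ htu ht)
      (fun t u htu ht => hτ _ _ (neg_inj.1 htu) ht)
    rw [← neg_inj, ← Finset.sum_neg_distrib, ← Finset.sum_neg_distrib]
    refine Eq.trans (Finset.sum_congr rfl fun (t : d.supp) _ => ?_)
      (h.trans (Finset.sum_congr rfl fun (t : d.supp) _ => ?_))
    · change -(d.mass t * (if P t then (θ : ℝ) else 0)) = d.mass t * (if P t then -(θ : ℝ) else 0)
      split_ifs <;> ring
    · change d.mass t * (-d.ironedTau t * if P t then 1 else 0) = _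
      ring
  · push Not at hP
    simp [hP]

/-- Truthfulness of the threshold price for a buyer. -/
theorem buyer_threshold_ic {P : d.supp → Prop} [DecidablePred P]
    (hup : ∀ t u, t ≤ u → P t → P u) (t u : d.supp) :
    t * (if P u then (1 : ℝ) else 0) - (if P u then d.lowestWinning P else 0)
      ≤ t * (if P t then 1 else 0) - (if P t then d.lowestWinning P else 0) := by
  by_cases hP : ∃ t, P t
  · obtain ⟨θ, hθ, hmin, he⟩ := exists_threshold_buyer hP
    rw [he]
    by_cases ht : P t
    · have : (θ : ℝ) ≤ t := hmin t ht
      split_ifs <;> linarith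
    · have : (t : ℝ) ≤ θ := le_of_not_ge fun h => ht (hup θ t h hθ)
      split_ifs <;> linarith
  · push Not at hP
    simp [hP]

theorem buyer_threshold_ir {P : d.supp → Prop} [DecidablePred P] (t : d.supp) :
    0 ≤ t * (if P t then (1 : ℝ) else 0) - (if P t then d.lowestWinning P else 0) := by
  by_cases ht : P t
  · obtain ⟨θ, hθ, hmin, he⟩ := exists_threshold_buyer ⟨t, ht⟩
    have : (θ : ℝ) ≤ t := hmin t ht
    rw [he, if_pos ht, if_pos ht]
    linarith
  · simp [ht]

/-- Truthfulness of the threshold gain for a seller. -/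
theorem seller_threshold_ic {P : d.supp → Prop} [DecidablePred P]
    (hdown : ∀ t u, t ≤ u → P u → P t) (t u : d.supp) :
    (if P u then d.highestWinning P else 0) - t * (if P u then (1 : ℝ) else 0)
      ≤ (if P t then d.highestWinning P else 0) - t * (if P t then 1 else 0) := by
  by_cases hP : ∃ t, P t
  · obtain ⟨θ, hθ, hmax, he⟩ := exists_threshold_seller hP
    rw [he]
    by_cases ht : P t
    · have : (t : ℝ) ≤ θ := hmax t ht
      split_ifs <;> linarith
    · have : (θ : ℝ) ≤ t := le_of_not_ge fun h => ht (hdown t θ h hθ)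
      split_ifs <;> linarith
  · push Not at hP
    simp [hP]

theorem seller_threshold_ir {P : d.supp → Prop} [DecidablePred P] (t : d.supp) :
    0 ≤ (if P t then d.highestWinning P else 0) - t * (if P t then (1 : ℝ) else 0) := by
  by_cases ht : P t
  · obtain ⟨θ, hθ, hmax, he⟩ := exists_threshold_seller ⟨t, ht⟩
    have : (t : ℝ) ≤ θ := hmax t ht
    rw [he, if_pos ht, if_pos ht]
    linarith
  · simp [ht]

end ValueDist

/-! ### Expectations over independent types -/

theorem ValueDist.sum_mass (d : ValueDist) : ∑ t : d.supp, d.mass t = 1 :=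
  (Finset.sum_coe_sort d.supp d.mass).trans d.mass_sum

/-- Redrawing one coordinate of a random vector with independent coordinates does not change
expectations. The map exchanging the old and the new coordinate is a weight-preserving
involution. -/
theorem sum_prod_update {ι : Type*} [Fintype ι] [DecidableEq ι] {α : ι → Type*}
    [∀ i, Fintype (α i)] (w : ∀ i, α i → ℝ) (hw : ∀ i, ∑ t, w i t = 1) (i : ι)
    (g : (∀ i, α i) → ℝ) :
    ∑ b, (∏ k, w k (b k)) * ∑ t, w i t * g (Function.update b i t)
      = ∑ b, (∏ k, w k (b k)) * g b := by
  have hinv : Function.Involutive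
      fun p : (∀ i, α i) × α i => (Function.update p.1 i p.2, p.1 i) := by
    rintro ⟨b, t⟩
    simp
  have hweight : ∀ (b : ∀ i, α i) (t : α i),
      w i t * ∏ k, w k (b k) = w i (b i) * ∏ k, w k (Function.update b i t k) := by
    intro b t
    rw [← Finset.mul_prod_erase _ _ (Finset.mem_univ i),
      ← Finset.mul_prod_erase _ (fun k => w k (Function.update b i t k)) (Finset.mem_univ i)]
    have : ∏ k ∈ Finset.univ.erase i, w k (Function.update b i t k)
        = ∏ k ∈ Finset.univ.erase i, w k (b k) :=
      Finset.prod_congr rfl fun k hk => by rw [Function.update_of_ne (Finset.ne_of_mem_erase hk)]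
    rw [this, Function.update_self]
    ring
  calc ∑ b, (∏ k, w k (b k)) * ∑ t, w i t * g (Function.update b i t)
      = ∑ p : (∀ i, α i) × α i,
          w i (p.1 i) * ((∏ k, w k (Function.update p.1 i p.2 k)) *
            g (Function.update p.1 i p.2)) := by
        rw [Fintype.sum_prod_type]
        refine Finset.sum_congr rfl fun b _ => ?_
        rw [Finset.mul_sum]
        refine Finset.sum_congr rfl fun t _ => ?_
        rw [← mul_assoc, ← mul_assoc, ← hweight]
        ring
    _ = ∑ p : (∀ i, α i) × α i, w i p.2 * ((∏ k, w k (p.1 k)) * g p.1) :=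
        Equiv.sum_comp hinv.toPerm
          fun p : (∀ i, α i) × α i => w i p.2 * ((∏ k, w k (p.1 k)) * g p.1)
    _ = _ := by
        rw [Fintype.sum_prod_type]
        refine Finset.sum_congr rfl fun b _ => ?_
        change ∑ t, w i t * ((∏ k, w k (b k)) * g b) = _
        rw [← Finset.sum_mul, hw, one_mul]

/-- The expectation of a product of functions of distinct independent coordinates. -/
theorem sum_prod_mul_prod {ι : Type*} [Fintype ι] [DecidableEq ι] {α : ι → Type*}
    [∀ i, Fintype (α i)] (w : ∀ i, α i → ℝ) (hw : ∀ i, ∑ t, w i t = 1) (A : Finset ι)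
    (u : ∀ i, α i → ℝ) :
    ∑ b : ∀ i, α i, (∏ k, w k (b k)) * ∏ i ∈ A, u i (b i) = ∏ i ∈ A, ∑ t, w i t * u i t := by
  classical
  have h1 : ∀ b : ∀ i, α i, (∏ k, w k (b k)) * ∏ i ∈ A, u i (b i)
      = ∏ i, (w i (b i) * if i ∈ A then u i (b i) else 1) := by
    intro b
    rw [Finset.prod_mul_distrib, Finset.prod_ite_mem, Finset.univ_inter]
  simp_rw [h1]
  rw [← Fintype.piFinset_univ, ← Finset.prod_univ_sum (fun i => (Finset.univ : Finset (α i)))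
    (fun i t => w i t * if i ∈ A then u i t else 1), ← Finset.univ_inter A, ← Finset.prod_ite_mem]
  refine Finset.prod_congr rfl fun i _ => ?_
  by_cases hi : i ∈ A <;> simp [hi, hw]

namespace Market

variable {n m : ℕ} (D : Market n m)

theorem weight_nonneg (b : D.BProfile) (s : D.SProfile) : 0 ≤ D.weight b s :=
  mul_nonneg (Finset.prod_nonneg fun i _ => ((D.buyer i).mass_pos _ (b i).2).le)
    (Finset.prod_nonneg fun j _ => ((D.seller j).mass_pos _ (s j).2).le)

theorem expect_mono {g h : D.BProfile → D.SProfile → ℝ} (hgh : ∀ b s, g b s ≤ h b s) :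
    D.expect g ≤ D.expect h :=
  Finset.sum_le_sum fun b _ => Finset.sum_le_sum fun s _ =>
    mul_le_mul_of_nonneg_left (hgh b s) (D.weight_nonneg b s)

theorem expect_add (g h : D.BProfile → D.SProfile → ℝ) :
    D.expect (fun b s => g b s + h b s) = D.expect g + D.expect h := by
  simp only [expect, mul_add, Finset.sum_add_distrib]

theorem expect_sub (g h : D.BProfile → D.SProfile → ℝ) :
    D.expect (fun b s => g b s - h b s) = D.expect g - D.expect h := by
  simp only [expect, mul_sub, Finset.sum_sub_distrib]

theorem expect_mul_left (c : ℝ) (g : D.BProfile → D.SProfile → ℝ) :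
    D.expect (fun b s => c * g b s) = c * D.expect g := by
  simp only [expect, Finset.mul_sum, mul_left_comm]

theorem expect_sum {κ : Type*} (K : Finset κ) (g : κ → D.BProfile → D.SProfile → ℝ) :
    D.expect (fun b s => ∑ k ∈ K, g k b s) = ∑ k ∈ K, D.expect (g k) := by
  simp only [expect, Finset.mul_sum]
  rw [Finset.sum_comm (s := K)]
  refine Finset.sum_congr rfl fun b _ => ?_
  rw [Finset.sum_comm]

/-- Functions of distinct agents' types are uncorrelated. -/
theorem expect_prod (A : Finset (Fin n)) (B : Finset (Fin m))
    (u : ∀ i, (D.buyer i).supp → ℝ) (v : ∀ j, (D.seller j).supp → ℝ) :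
    D.expect (fun b s => (∏ i ∈ A, u i (b i)) * ∏ j ∈ B, v j (s j))
      = (∏ i ∈ A, ∑ t : (D.buyer i).supp, (D.buyer i).mass t * u i t) *
          ∏ j ∈ B, ∑ t : (D.seller j).supp, (D.seller j).mass t * v j t := by
  rw [← sum_prod_mul_prod (fun i (t : (D.buyer i).supp) => (D.buyer i).mass t)
      (fun i => (D.buyer i).sum_mass) A u,
    ← sum_prod_mul_prod (fun j (t : (D.seller j).supp) => (D.seller j).mass t)
      (fun j => (D.seller j).sum_mass) B v, Finset.sum_mul_sum]
  refine Finset.sum_congr rfl fun b _ => Finset.sum_congr rfl fun s _ => ?_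
  rw [weight]
  ring

theorem expect_const (c : ℝ) : D.expect (fun _ _ => c) = c := by
  have h := D.expect_prod ∅ ∅ (fun _ _ => 0) (fun _ _ => 0)
  have h2 := D.expect_mul_left c (fun _ _ => 1)
  simp only [Finset.prod_empty, mul_one] at h h2
  rw [h2, h, mul_one]

theorem expect_nonneg {g : D.BProfile → D.SProfile → ℝ} (hg : ∀ b s, 0 ≤ g b s) :
    0 ≤ D.expect g := by
  simpa [D.expect_const] using D.expect_mono (g := fun _ _ => 0) hg

/-- Redrawing one buyer's type does not change expectations. -/
theorem expect_redraw_buyer (g : D.BProfile → D.SProfile → ℝ) (i : Fin n) :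
    D.expect (fun b s => ∑ t : (D.buyer i).supp, (D.buyer i).mass t * g (Function.update b i t) s)
      = D.expect g := by
  have h := sum_prod_update (fun i (t : (D.buyer i).supp) => (D.buyer i).mass t)
    (fun i => (D.buyer i).sum_mass) i
    (fun b => ∑ s : D.SProfile, (∏ j, (D.seller j).mass (s j)) * g b s)
  refine Eq.trans ?_ (h.trans ?_)
  · refine Finset.sum_congr rfl fun b _ => ?_
    simp only [weight, Finset.mul_sum]
    rw [Finset.sum_comm]
    refine Finset.sum_congr rfl fun t _ => Finset.sum_congr rfl fun s _ => ?_
    ring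
  · refine Finset.sum_congr rfl fun b _ => ?_
    simp only [weight, Finset.mul_sum]
    refine Finset.sum_congr rfl fun s _ => ?_
    ring

/-- Redrawing one seller's type does not change expectations. -/
theorem expect_redraw_seller (g : D.BProfile → D.SProfile → ℝ) (j : Fin m) :
    D.expect (fun b s => ∑ t : (D.seller j).supp, (D.seller j).mass t * g b (Function.update s j t))
      = D.expect g := by
  refine Finset.sum_congr rfl fun b _ => ?_
  simp only [weight, mul_assoc]
  rw [← Finset.mul_sum, ← Finset.mul_sum]
  congr 1
  exact sum_prod_update (fun j (t : (D.seller j).supp) => (D.seller j).mass t)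
    (fun j => (D.seller j).sum_mass) j (g b)

theorem sum_interimB (g : D.BProfile → D.SProfile → ℝ) (i : Fin n) :
    ∑ t : (D.buyer i).supp, (D.buyer i).mass t * D.interimB g i t = D.expect g := by
  rw [← D.expect_redraw_buyer g i, expect_sum]
  exact Finset.sum_congr rfl fun t _ => (D.expect_mul_left _ _).symm

theorem sum_interimS (g : D.BProfile → D.SProfile → ℝ) (j : Fin m) :
    ∑ t : (D.seller j).supp, (D.seller j).mass t * D.interimS g j t = D.expect g := by
  rw [← D.expect_redraw_seller g j, expect_sum]
  exact Finset.sum_congr rfl fun t _ => (D.expect_mul_left _ _).symm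

/-- If a non-negative quantity has expectation zero, so do all its interim expectations. -/
theorem interimB_eq_zero {g : D.BProfile → D.SProfile → ℝ} (hg : ∀ b s, 0 ≤ g b s)
    (h0 : D.expect g ≤ 0) (i : Fin n) (t : (D.buyer i).supp) : D.interimB g i t = 0 := by
  have hnn : ∀ t : (D.buyer i).supp, 0 ≤ (D.buyer i).mass t * D.interimB g i t := fun t =>
    mul_nonneg ((D.buyer i).mass_pos _ t.2).le (D.expect_nonneg fun _ _ => hg _ _)
  have h := (Finset.sum_eq_zero_iff_of_nonneg fun t _ => hnn t).1
    (le_antisymm ((D.sum_interimB g i).trans_le h0) (Finset.sum_nonneg fun t _ => hnn t)) t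
    (Finset.mem_univ t)
  exact (mul_eq_zero.1 h).resolve_left ((D.buyer i).mass_pos _ t.2).ne'

theorem interimS_eq_zero {g : D.BProfile → D.SProfile → ℝ} (hg : ∀ b s, 0 ≤ g b s)
    (h0 : D.expect g ≤ 0) (j : Fin m) (t : (D.seller j).supp) : D.interimS g j t = 0 := by
  have hnn : ∀ t : (D.seller j).supp, 0 ≤ (D.seller j).mass t * D.interimS g j t := fun t =>
    mul_nonneg ((D.seller j).mass_pos _ t.2).le (D.expect_nonneg fun _ _ => hg _ _)
  have h := (Finset.sum_eq_zero_iff_of_nonneg fun t _ => hnn t).1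
    (le_antisymm ((D.sum_interimS g j).trans_le h0) (Finset.sum_nonneg fun t _ => hnn t)) t
    (Finset.mem_univ t)
  exact (mul_eq_zero.1 h).resolve_left ((D.seller j).mass_pos _ t.2).ne'

end Market

/-! ### The SBB transformation -/

namespace Mechanism

variable {n m : ℕ} {D : Market n m} (M : Mechanism D)

/-- Balancing keeps a buyer's interim payments: given her type, every other factor of the balancing
product averages to its expectation and cancels against the denominator. A buyer who is not active
has interim payments zero. -/
theorem interimB_balance (hnn : ∀ i b s, 0 ≤ M.payB i b s) (i : Fin n) (t : (D.buyer i).supp) :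
    D.interimB (M.balance.payB i) i t = D.interimB (M.payB i) i t := by
  classical
  by_cases hi : i ∈ M.activeB
  · have hpos : ∀ k ∈ M.activeB, 0 < D.expect (M.payB k) := fun k hk => (Finset.mem_filter.1 hk).2
    have hposS : ∀ k ∈ M.activeS, 0 < D.expect (M.payS k) := fun k hk => (Finset.mem_filter.1 hk).2
    have hp := D.expect_prod (M.activeB.erase i) M.activeS (fun k => D.interimB (M.payB k) k)
      (fun k => D.interimS (M.payS k) k)
    simp only [D.sum_interimB, D.sum_interimS] at hp
    have h1 : ∀ b s, M.balance.payB i (Function.update b i t) s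
        = D.interimB (M.payB i) i t * D.expect (M.payB i) /
            ((∏ i ∈ M.activeB, D.expect (M.payB i)) * ∏ j ∈ M.activeS, D.expect (M.payS j)) *
          ((∏ k ∈ M.activeB.erase i, D.interimB (M.payB k) k (b k)) *
            ∏ j ∈ M.activeS, D.interimS (M.payS j) j (s j)) := by
      intro b s
      have h2 : ∏ k ∈ M.activeB, D.interimB (M.payB k) k (Function.update b i t k)
          = D.interimB (M.payB i) i t *
            ∏ k ∈ M.activeB.erase i, D.interimB (M.payB k) k (b k) := by
        rw [← Finset.mul_prod_erase _ _ hi, Function.update_self]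
        congr 1
        exact Finset.prod_congr rfl fun k hk => by
          rw [Function.update_of_ne (Finset.ne_of_mem_erase hk)]
      simp only [balance, if_pos hi, balanceFactor]
      rw [h2]
      ring
    rw [Market.interimB]
    simp only [h1]
    rw [D.expect_mul_left, hp, ← Finset.mul_prod_erase _ (fun i => D.expect (M.payB i)) hi]
    have e1 := (hpos i hi).ne'
    have e2 : ∏ k ∈ M.activeB.erase i, D.expect (M.payB k) ≠ 0 :=
      Finset.prod_ne_zero_iff.2 fun k hk => (hpos k (Finset.mem_of_mem_erase hk)).ne'
    have e3 : ∏ k ∈ M.activeS, D.expect (M.payS k) ≠ 0 :=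
      Finset.prod_ne_zero_iff.2 fun k hk => (hposS k hk).ne'
    field_simp
  · rw [D.interimB_eq_zero (hnn i) <| not_lt.1 fun h =>
      hi (Finset.mem_filter.2 ⟨Finset.mem_univ _, h⟩)]
    simp [balance, hi, Market.interimB, D.expect_const]

/-- Balancing keeps a seller's interim gains. -/
theorem interimS_balance (hnn : ∀ j b s, 0 ≤ M.payS j b s) (j : Fin m) (t : (D.seller j).supp) :
    D.interimS (M.balance.payS j) j t = D.interimS (M.payS j) j t := by
  classical
  by_cases hj : j ∈ M.activeS
  · have hpos : ∀ k ∈ M.activeB, 0 < D.expect (M.payB k) := fun k hk => (Finset.mem_filter.1 hk).2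
    have hposS : ∀ k ∈ M.activeS, 0 < D.expect (M.payS k) := fun k hk => (Finset.mem_filter.1 hk).2
    have hp := D.expect_prod M.activeB (M.activeS.erase j) (fun k => D.interimB (M.payB k) k)
      (fun k => D.interimS (M.payS k) k)
    simp only [D.sum_interimB, D.sum_interimS] at hp
    have h1 : ∀ b s, M.balance.payS j b (Function.update s j t)
        = D.interimS (M.payS j) j t * D.expect (M.payS j) /
            ((∏ i ∈ M.activeB, D.expect (M.payB i)) * ∏ j ∈ M.activeS, D.expect (M.payS j)) *
          ((∏ k ∈ M.activeB, D.interimB (M.payB k) k (b k)) *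
            ∏ k ∈ M.activeS.erase j, D.interimS (M.payS k) k (s k)) := by
      intro b s
      have h2 : ∏ k ∈ M.activeS, D.interimS (M.payS k) k (Function.update s j t k)
          = D.interimS (M.payS j) j t *
            ∏ k ∈ M.activeS.erase j, D.interimS (M.payS k) k (s k) := by
        rw [← Finset.mul_prod_erase _ _ hj, Function.update_self]
        congr 1
        exact Finset.prod_congr rfl fun k hk => by
          rw [Function.update_of_ne (Finset.ne_of_mem_erase hk)]
      simp only [balance, if_pos hj, balanceFactor]
      rw [h2]
      ring
    rw [Market.interimS]
    simp only [h1]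
    rw [D.expect_mul_left, hp, ← Finset.mul_prod_erase _ (fun j => D.expect (M.payS j)) hj]
    have e1 := (hposS j hj).ne'
    have e2 : ∏ k ∈ M.activeB, D.expect (M.payB k) ≠ 0 :=
      Finset.prod_ne_zero_iff.2 fun k hk => (hpos k hk).ne'
    have e3 : ∏ k ∈ M.activeS.erase j, D.expect (M.payS k) ≠ 0 :=
      Finset.prod_ne_zero_iff.2 fun k hk => (hposS k (Finset.mem_of_mem_erase hk)).ne'
    field_simp
  · rw [D.interimS_eq_zero (hnn j) <| not_lt.1 fun h =>
      hj (Finset.mem_filter.2 ⟨Finset.mem_univ _, h⟩)]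
    simp [balance, hj, Market.interimS, D.expect_const]

theorem surplus_eq : M.surplus = ∑ i, D.expect (M.payB i) - ∑ j, D.expect (M.payS j) := by
  rw [surplus, D.expect_sub, D.expect_sum, D.expect_sum]

theorem balance_isSBB (hB : ∀ i b s, 0 ≤ M.payB i b s) (hS : ∀ j b s, 0 ≤ M.payS j b s)
    (h : M.surplus = 0) : M.balance.IsSBB := by
  intro b s
  have hactB : ∑ i ∈ M.activeB, D.expect (M.payB i) = ∑ i, D.expect (M.payB i) := by
    rw [activeB, Finset.sum_filter_of_ne]
    exact fun i _ hi => (D.expect_nonneg (hB i)).lt_of_ne' hi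
  have hactS : ∑ j ∈ M.activeS, D.expect (M.payS j) = ∑ j, D.expect (M.payS j) := by
    rw [activeS, Finset.sum_filter_of_ne]
    exact fun j _ hj => (D.expect_nonneg (hS j)).lt_of_ne' hj
  rw [surplus_eq, sub_eq_zero] at h
  simp only [balance]
  rw [Finset.sum_ite_mem, Finset.sum_ite_mem, Finset.univ_inter, Finset.univ_inter,
    ← Finset.mul_sum, ← Finset.mul_sum, hactB, hactS, h]

/-- The SBB transformation works whenever the payments are non-negative and there is no deficit.
Handing out the surplus needs a seller to receive it. -/
theorem sbbTransform_spec (hIR : M.IsIR) (hBIC : M.IsBIC) (hB : ∀ i b s, 0 ≤ M.payB i b s)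
    (hS : ∀ j b s, 0 ≤ M.payS j b s) (hsur : 0 ≤ M.surplus) (hm : m = 0 → M.surplus = 0) :
    M.sbbTransform.IsIR ∧ M.sbbTransform.IsBIC ∧ M.sbbTransform.IsSBB := by
  have hc : 0 ≤ M.surplus / m := div_nonneg hsur (Nat.cast_nonneg m)
  have hS' : ∀ j b s, 0 ≤ M.shareSurplus.payS j b s := fun j b s => add_nonneg (hS j b s) hc
  have hzero : M.shareSurplus.surplus = 0 := by
    have h1 : ∀ j, D.expect (M.shareSurplus.payS j) = D.expect (M.payS j) + M.surplus / m := by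
      intro j
      simp only [shareSurplus]
      rw [D.expect_add, D.expect_const]
    have h2 : ∀ i, D.expect (M.shareSurplus.payB i) = D.expect (M.payB i) := fun _ => rfl
    rw [surplus_eq]
    simp only [h1, h2, Finset.sum_add_distrib, Finset.sum_const, Finset.card_univ,
      Fintype.card_fin, nsmul_eq_mul]
    -- for `m = 0` the division is by zero, and the surplus vanishes by hypothesis
    have h3 : (m : ℝ) * (M.surplus / m) = M.surplus := by
      rcases Nat.eq_zero_or_pos m with h | h
      · rw [hm h, zero_div, mul_zero]
      · field_simp
    rw [h3, surplus_eq]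
    ring
  have hutilB : ∀ i v t, M.sbbTransform.utilB i v t = M.utilB i v t := by
    intro i v t
    have := M.shareSurplus.interimB_balance hB i t
    change v * D.interimB (M.xB i) i t - D.interimB (M.shareSurplus.balance.payB i) i t = _
    rw [this]
    rfl
  have hutilS : ∀ j v t, M.sbbTransform.utilS j v t = M.utilS j v t + M.surplus / m := by
    intro j v t
    have := M.shareSurplus.interimS_balance hS' j t
    change D.interimS (M.shareSurplus.balance.payS j) j t - v * D.interimS (M.xS j) j t = _
    rw [this, utilS]
    have h : D.interimS (M.shareSurplus.payS j) j t
        = D.interimS (M.payS j) j t + M.surplus / m := by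
      simp only [shareSurplus, Market.interimS]
      rw [D.expect_add, D.expect_const]
    rw [h]
    ring
  refine ⟨⟨fun i t => ?_, fun j t => ?_⟩, ⟨fun i t t' => ?_, fun j t t' => ?_⟩,
    M.shareSurplus.balance_isSBB hB hS' hzero⟩
  · rw [hutilB]; exact hIR.1 i t
  · rw [hutilS]; exact add_nonneg (hIR.2 j t) hc
  · rw [hutilB, hutilB]; exact hBIC.1 i t t'
  · rw [hutilS, hutilS]; exact add_le_add_left (hBIC.2 j t t') _

end Mechanism

/-! ### The upper bound on the gains from trade -/

namespace Market

variable {n m : ℕ} (D : Market n m)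

/-- In a matching, a sum over the buyers of the pairs runs over each matched buyer once. -/
theorem sum_fst {S : Finset (Fin n × Fin m)} (hS : S ∈ D.feasible) (g : Fin n → ℝ) :
    ∑ e ∈ S, g e.1 = ∑ i, g i * if ∃ j, (i, j) ∈ S then 1 else 0 := by
  classical
  have hinj : Set.InjOn Prod.fst (S : Set (Fin n × Fin m)) := by
    rintro ⟨i, j⟩ h ⟨i', j'⟩ h' (rfl : i = i')
    rw [D.matching_buyer S hS i j j' h h']
  rw [← Finset.sum_image (f := g) hinj]
  simp only [mul_ite, mul_one, mul_zero]
  rw [← Finset.sum_filter]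
  refine Finset.sum_congr ?_ fun _ _ => rfl
  ext i
  simp

/-- In a matching, a sum over the sellers of the pairs runs over each matched seller once. -/
theorem sum_snd {S : Finset (Fin n × Fin m)} (hS : S ∈ D.feasible) (g : Fin m → ℝ) :
    ∑ e ∈ S, g e.2 = ∑ j, g j * if ∃ i, (i, j) ∈ S then 1 else 0 := by
  classical
  have hinj : Set.InjOn Prod.snd (S : Set (Fin n × Fin m)) := by
    rintro ⟨i, j⟩ h ⟨i', j'⟩ h' (rfl : j = j')
    rw [D.matching_seller S hS i i' j h h']
  rw [← Finset.sum_image (f := g) hinj]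
  simp only [mul_ite, mul_one, mul_zero]
  rw [← Finset.sum_filter]
  refine Finset.sum_congr ?_ fun _ _ => rfl
  ext j
  simp

/-- The weight of the maximum weight matching. -/
noncomputable def maxWeight (rank : Finset (Fin n × Fin m) → ℕ) (w : Fin n × Fin m → ℝ) : ℝ :=
  ∑ e ∈ D.maxMatching rank w, w e

theorem maxMatching_mem_maximizers (rank : Finset (Fin n × Fin m) → ℕ) (w : Fin n × Fin m → ℝ) :
    D.maxMatching rank w ∈ D.maximizers w :=
  ((D.maximizers w).exists_min_image rank (D.maximizers_nonempty w)).choose_spec.1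

theorem sum_le_maxWeight (rank : Finset (Fin n × Fin m) → ℕ) (w : Fin n × Fin m → ℝ)
    {S : Finset (Fin n × Fin m)} (hS : S ∈ D.feasible) :
    ∑ e ∈ S, w e ≤ D.maxWeight rank w :=
  (Finset.mem_filter.1 (D.maxMatching_mem_maximizers rank w)).2 S hS

end Market

namespace Mechanism

variable {n m : ℕ} {D : Market n m} (M : Mechanism D)

theorem xB_nonneg (i : Fin n) (b : D.BProfile) (s : D.SProfile) : 0 ≤ M.xB i b s :=
  Finset.sum_nonneg fun S _ => mul_nonneg (M.prob_nonneg b s S) (by split_ifs <;> norm_num)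

theorem xS_nonneg (j : Fin m) (b : D.BProfile) (s : D.SProfile) : 0 ≤ M.xS j b s :=
  Finset.sum_nonneg fun S _ => mul_nonneg (M.prob_nonneg b s S) (by split_ifs <;> norm_num)

theorem sum_mul_xB (g : Fin n → ℝ) (b : D.BProfile) (s : D.SProfile) :
    ∑ i, g i * M.xB i b s = ∑ S ∈ D.feasible, M.prob b s S * ∑ e ∈ S, g e.1 := by
  simp only [xB, Finset.mul_sum]
  rw [Finset.sum_comm]
  refine Finset.sum_congr rfl fun S hS => ?_
  rw [← Finset.mul_sum, D.sum_fst hS, Finset.mul_sum]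
  exact Finset.sum_congr rfl fun i _ => by ring

theorem sum_mul_xS (g : Fin m → ℝ) (b : D.BProfile) (s : D.SProfile) :
    ∑ j, g j * M.xS j b s = ∑ S ∈ D.feasible, M.prob b s S * ∑ e ∈ S, g e.2 := by
  simp only [xS, Finset.mul_sum]
  rw [Finset.sum_comm]
  refine Finset.sum_congr rfl fun S hS => ?_
  rw [← Finset.mul_sum, D.sum_snd hS, Finset.mul_sum]
  exact Finset.sum_congr rfl fun i _ => by ring

/-- The expected weight of the traded pairs. -/
noncomputable def expectedWeight (w : D.BProfile → D.SProfile → Fin n × Fin m → ℝ) : ℝ :=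
  D.expect fun b s => ∑ S ∈ D.feasible, M.prob b s S * ∑ e ∈ S, w b s e

theorem expectedWeight_le_maxWeight (rank : Finset (Fin n × Fin m) → ℕ)
    (w : D.BProfile → D.SProfile → Fin n × Fin m → ℝ) :
    M.expectedWeight w ≤ D.expect fun b s => D.maxWeight rank (w b s) := by
  refine D.expect_mono fun b s => ?_
  calc ∑ S ∈ D.feasible, M.prob b s S * ∑ e ∈ S, w b s e
      ≤ ∑ S ∈ D.feasible, M.prob b s S * D.maxWeight rank (w b s) :=
        Finset.sum_le_sum fun S hS =>
          mul_le_mul_of_nonneg_left (D.sum_le_maxWeight rank _ hS) (M.prob_nonneg b s S)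
    _ = D.maxWeight rank (w b s) := by rw [← Finset.sum_mul, M.prob_sum, one_mul]

theorem expectedWeight_sub (w w' : D.BProfile → D.SProfile → Fin n × Fin m → ℝ) :
    M.expectedWeight (fun b s e => w b s e - w' b s e)
      = M.expectedWeight w - M.expectedWeight w' := by
  simp only [expectedWeight, Finset.sum_sub_distrib, mul_sub]
  rw [D.expect_sub]

theorem expectedWeight_mono {w w' : D.BProfile → D.SProfile → Fin n × Fin m → ℝ}
    (h : ∀ b s e, w b s e ≤ w' b s e) : M.expectedWeight w ≤ M.expectedWeight w' :=
  D.expect_mono fun b s => Finset.sum_le_sum fun S _ =>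
    mul_le_mul_of_nonneg_left (Finset.sum_le_sum fun e _ => h b s e) (M.prob_nonneg b s S)

theorem sum_expect_mul_xB (g : Fin n → ℝ → ℝ) :
    ∑ i, D.expect (fun b s => g i (b i) * M.xB i b s)
      = M.expectedWeight fun b _ e => g e.1 (b e.1) := by
  rw [← D.expect_sum, expectedWeight]
  congr 1
  funext b s
  exact M.sum_mul_xB (fun i => g i (b i)) b s

theorem sum_expect_mul_xS (g : Fin m → ℝ → ℝ) :
    ∑ j, D.expect (fun b s => g j (s j) * M.xS j b s)
      = M.expectedWeight fun _ s e => g e.2 (s e.2) := by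
  rw [← D.expect_sum, expectedWeight]
  congr 1
  funext b s
  exact M.sum_mul_xS (fun j => g j (s j)) b s

theorem expect_mul_xB (g : ℝ → ℝ) (i : Fin n) :
    D.expect (fun b s => g (b i) * M.xB i b s)
      = ∑ t : (D.buyer i).supp, (D.buyer i).mass t * (g t * D.interimB (M.xB i) i t) := by
  rw [← D.sum_interimB _ i]
  refine Finset.sum_congr rfl fun t _ => ?_
  simp only [Market.interimB, Function.update_self]
  rw [D.expect_mul_left]

theorem expect_mul_xS (g : ℝ → ℝ) (j : Fin m) :
    D.expect (fun b s => g (s j) * M.xS j b s)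
      = ∑ t : (D.seller j).supp, (D.seller j).mass t * (g t * D.interimS (M.xS j) j t) := by
  rw [← D.sum_interimS _ j]
  refine Finset.sum_congr rfl fun t _ => ?_
  simp only [Market.interimS, Function.update_self]
  rw [D.expect_mul_left]

/-- The total virtual value of the trading buyers bounds the expected revenue. -/
theorem revenue_le (hIR : M.IsIR) (hBIC : M.IsBIC) :
    ∑ i, D.expect (M.payB i) ≤ M.expectedWeight fun b _ e => (D.buyer e.1).ironedPhi (b e.1) := by
  rw [← M.sum_expect_mul_xB fun i => (D.buyer i).ironedPhi]
  refine Finset.sum_le_sum fun i _ => ?_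
  rw [M.expect_mul_xB, ← D.sum_interimB _ i]
  exact (D.buyer i).buyer_payment_le (fun t => D.expect_nonneg fun _ _ => M.xB_nonneg i _ _)
    (fun t u => hBIC.1 i t u) (fun t => hIR.1 i t)

/-- The total virtual value of the trading sellers is at most their expected gain. -/
theorem le_gain (hIR : M.IsIR) (hBIC : M.IsBIC) :
    (M.expectedWeight fun _ s e => (D.seller e.2).ironedTau (s e.2))
      ≤ ∑ j, D.expect (M.payS j) := by
  rw [← M.sum_expect_mul_xS fun j => (D.seller j).ironedTau]
  refine Finset.sum_le_sum fun j _ => ?_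
  rw [M.expect_mul_xS, ← D.sum_interimS _ j]
  exact (D.seller j).le_seller_gain (fun t => D.expect_nonneg fun _ _ => M.xS_nonneg j _ _)
    (fun t u => hBIC.2 j t u) (fun t => hIR.2 j t)

/-- Budget balance makes the total virtual surplus of the traded pairs non-negative, so it may be
added to the gains from trade; the sum regroups into the two objectives of GSOM and GBOM. -/
theorem GFT_le (rank : Finset (Fin n × Fin m) → ℕ) (hIR : M.IsIR) (hBIC : M.IsBIC)
    (hWBB : M.IsExAnteWBB) :
    M.GFT ≤
      D.expect (fun b s => D.maxWeight rank fun e =>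
        (D.buyer e.1).ironedPhi (b e.1) - (s e.2 : ℝ)) +
      D.expect (fun b s => D.maxWeight rank fun e =>
        (b e.1 : ℝ) - (D.seller e.2).ironedTau (s e.2)) := by
  have h1 := M.revenue_le hIR hBIC
  have h2 := M.le_gain hIR hBIC
  rw [IsExAnteWBB, D.expect_sum, D.expect_sum] at hWBB
  have h3 := M.expectedWeight_le_maxWeight rank
    fun b s e => (D.buyer e.1).ironedPhi (b e.1) - (s e.2 : ℝ)
  have h4 := M.expectedWeight_le_maxWeight rank
    fun b s e => (b e.1 : ℝ) - (D.seller e.2).ironedTau (s e.2)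
  have h5 : M.GFT = M.expectedWeight fun b s e => (b e.1 : ℝ) - (s e.2 : ℝ) := rfl
  rw [M.expectedWeight_sub] at h3 h4 h5
  linarith

end Mechanism

/-! ### Threshold mechanisms for virtual welfare maximization -/

namespace Market

variable {n m : ℕ} (D : Market n m) (rank : Finset (Fin n × Fin m) → ℕ)

/-- If the weights of exactly the matchings with property `P` grow by the same positive amount, a
maximum weight matching with property `P` stays so: every new maximizer has property `P`. -/
theorem maxMatching_of_gain {P : Finset (Fin n × Fin m) → Prop} [DecidablePred P]
    {w w' : Fin n × Fin m → ℝ} {δ : ℝ} (hδ : 0 < δ)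
    (h : ∀ S ∈ D.feasible, ∑ e ∈ S, w' e = ∑ e ∈ S, w e + if P S then δ else 0)
    (hP : P (D.maxMatching rank w)) : P (D.maxMatching rank w') := by
  by_contra hcon
  have h1 := h _ (D.maxMatching_mem rank w)
  have h2 := h _ (D.maxMatching_mem rank w')
  have h3 := D.sum_le_maxWeight rank w (D.maxMatching_mem rank w')
  have h4 := D.sum_le_maxWeight rank w' (D.maxMatching_mem rank w)
  rw [if_pos hP] at h1
  rw [if_neg hcon] at h2
  simp only [maxWeight] at h3 h4
  linarith

/-- The maximum weight matching for the virtual surpluses `αᵢ(bᵢ) - βⱼ(sⱼ)`. -/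
noncomputable def virtualMatching (α : Fin n → ℝ → ℝ) (β : Fin m → ℝ → ℝ) (b : D.BProfile)
    (s : D.SProfile) : Finset (Fin n × Fin m) :=
  D.maxMatching rank fun e => α e.1 (b e.1) - β e.2 (s e.2)

variable {rank} {α : Fin n → ℝ → ℝ} {β : Fin m → ℝ → ℝ}

theorem virtualMatching_mem (b : D.BProfile) (s : D.SProfile) :
    D.virtualMatching rank α β b s ∈ D.feasible :=
  D.maxMatching_mem _ _

theorem sum_le_virtualMatching (b : D.BProfile) (s : D.SProfile) {S : Finset (Fin n × Fin m)}
    (hS : S ∈ D.feasible) :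
    ∑ e ∈ S, (α e.1 (b e.1) - β e.2 (s e.2)) ≤
      ∑ e ∈ D.virtualMatching rank α β b s, (α e.1 (b e.1) - β e.2 (s e.2)) :=
  D.sum_le_maxWeight rank (fun e => α e.1 (b e.1) - β e.2 (s e.2)) hS

/-- Changing one buyer's type shifts the weights of the matchings that serve her by a constant. -/
theorem sum_update_buyer (b : D.BProfile) (s : D.SProfile) (i : Fin n) (t : (D.buyer i).supp)
    {S : Finset (Fin n × Fin m)} (hS : S ∈ D.feasible) :
    ∑ e ∈ S, (α e.1 (Function.update b i t e.1) - β e.2 (s e.2)) =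
      ∑ e ∈ S, (α e.1 (b e.1) - β e.2 (s e.2)) +
        if ∃ j, (i, j) ∈ S then α i t - α i (b i) else 0 := by
  have h := D.sum_fst hS fun k => if k = i then α i t - α i (b i) else 0
  simp only [ite_mul, zero_mul, Finset.sum_ite_eq', Finset.mem_univ, if_true] at h
  simp only [mul_ite, mul_one, mul_zero] at h
  rw [← h, ← Finset.sum_add_distrib]
  refine Finset.sum_congr rfl fun e _ => ?_
  by_cases he : e.1 = i
  · obtain ⟨k, j⟩ := e
    obtain rfl : k = i := he
    simp
  · rw [Function.update_of_ne he, if_neg he, add_zero]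

/-- Changing one seller's type shifts the weights of the matchings that use her by a constant. -/
theorem sum_update_seller (b : D.BProfile) (s : D.SProfile) (j : Fin m) (t : (D.seller j).supp)
    {S : Finset (Fin n × Fin m)} (hS : S ∈ D.feasible) :
    ∑ e ∈ S, (α e.1 (b e.1) - β e.2 (Function.update s j t e.2)) =
      ∑ e ∈ S, (α e.1 (b e.1) - β e.2 (s e.2)) +
        if ∃ i, (i, j) ∈ S then β j (s j) - β j t else 0 := by
  have h := D.sum_snd hS fun k => if k = j then β j (s j) - β j t else 0
  simp only [ite_mul, zero_mul, Finset.sum_ite_eq', Finset.mem_univ, if_true] at h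
  simp only [mul_ite, mul_one, mul_zero] at h
  rw [← h, ← Finset.sum_add_distrib]
  refine Finset.sum_congr rfl fun e _ => ?_
  by_cases he : e.2 = j
  · obtain ⟨i, k⟩ := e
    obtain rfl : k = j := he
    simp
  · rw [Function.update_of_ne he, if_neg he, add_zero]

theorem virtualMatching_buyer_congr (b : D.BProfile) (s : D.SProfile) {i : Fin n}
    {t u : (D.buyer i).supp} (h : α i t = α i u) :
    D.virtualMatching rank α β (Function.update b i t) s
      = D.virtualMatching rank α β (Function.update b i u) s := by
  refine congrArg (D.maxMatching rank) (funext fun e => ?_)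
  by_cases he : e.1 = i
  · obtain ⟨k, j⟩ := e
    obtain rfl : k = i := he
    simp [h]
  · rw [Function.update_of_ne he, Function.update_of_ne he]

theorem virtualMatching_seller_congr (b : D.BProfile) (s : D.SProfile) {j : Fin m}
    {t u : (D.seller j).supp} (h : β j t = β j u) :
    D.virtualMatching rank α β b (Function.update s j t)
      = D.virtualMatching rank α β b (Function.update s j u) := by
  refine congrArg (D.maxMatching rank) (funext fun e => ?_)
  by_cases he : e.2 = j
  · obtain ⟨i, k⟩ := e
    obtain rfl : k = j := he
    simp [h]
  · rw [Function.update_of_ne he, Function.update_of_ne he]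

/-- A buyer who trades also trades at every larger type. -/
theorem virtualMatching_buyer_mono (b : D.BProfile) (s : D.SProfile) {i : Fin n}
    (hα : Monotone fun t : (D.buyer i).supp => α i t) (t u : (D.buyer i).supp) (htu : t ≤ u)
    (ht : ∃ j, (i, j) ∈ D.virtualMatching rank α β (Function.update b i t) s) :
    ∃ j, (i, j) ∈ D.virtualMatching rank α β (Function.update b i u) s := by
  rcases (hα htu).eq_or_lt with h | h
  · rwa [← D.virtualMatching_buyer_congr b s h]
  · refine D.maxMatching_of_gain rank (P := fun S => ∃ j, (i, j) ∈ S) (sub_pos.2 h)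
      (fun S hS => ?_) ht
    have := D.sum_update_buyer (α := α) (β := β) (Function.update b i t) s i u hS
    rwa [Function.update_idem, Function.update_self] at this

/-- A seller who trades also trades at every smaller type. -/
theorem virtualMatching_seller_anti (b : D.BProfile) (s : D.SProfile) {j : Fin m}
    (hβ : Monotone fun t : (D.seller j).supp => β j t) (t u : (D.seller j).supp) (htu : t ≤ u)
    (hu : ∃ i, (i, j) ∈ D.virtualMatching rank α β b (Function.update s j u)) :
    ∃ i, (i, j) ∈ D.virtualMatching rank α β b (Function.update s j t) := by
  rcases (hβ htu).eq_or_lt with h | h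
  · rwa [D.virtualMatching_seller_congr b s h]
  · refine D.maxMatching_of_gain rank (P := fun S => ∃ i, (i, j) ∈ S) (sub_pos.2 h)
      (fun S hS => ?_) hu
    have := D.sum_update_seller (α := α) (β := β) b (Function.update s j u) j t hS
    rwa [Function.update_idem, Function.update_self] at this

/-- Removing a pair from the chosen matching shows that a buyer's threshold price covers the virtual
cost of her partner, provided that she is charged according to her value. -/
theorem virtualCost_le_threshold {b : D.BProfile} {s : D.SProfile} {i : Fin n} {j : Fin m}
    (hij : (i, j) ∈ D.virtualMatching rank α β b s) {θ : (D.buyer i).supp}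
    (hθ : ∃ j', (i, j') ∈ D.virtualMatching rank α β (Function.update b i θ) s) :
    β j (s j) ≤ α i θ := by
  classical
  have hA := D.virtualMatching_mem (rank := rank) (α := α) (β := β) b s
  have hA' := D.virtualMatching_mem (rank := rank) (α := α) (β := β) (Function.update b i θ) s
  have hE : (D.virtualMatching rank α β b s).erase (i, j) ∈ D.feasible :=
    D.downward_closed _ hA _ (Finset.erase_subset _ _)
  have hnot : ¬ ∃ j', (i, j') ∈ (D.virtualMatching rank α β b s).erase (i, j) := by
    rintro ⟨j', hj'⟩
    obtain ⟨hne, hmem⟩ := Finset.mem_erase.1 hj'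
    exact hne (by rw [D.matching_buyer _ hA i j j' hij hmem])
  have h1 := D.sum_le_virtualMatching (rank := rank) (α := α) (β := β) (Function.update b i θ) s hE
  have h2 := D.sum_le_virtualMatching (rank := rank) (α := α) (β := β) b s hA'
  rw [D.sum_update_buyer b s i θ hE, D.sum_update_buyer b s i θ hA', if_neg hnot, if_pos hθ] at h1
  have h3 := Finset.add_sum_erase _
    (fun e : Fin n × Fin m => α e.1 (b e.1) - β e.2 (s e.2)) hij
  simp only at h3
  linarith

/-- Removing a pair from the chosen matching shows that a seller's threshold gain is covered by the
virtual value of her partner. -/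
theorem threshold_le_virtualValue {b : D.BProfile} {s : D.SProfile} {i : Fin n} {j : Fin m}
    (hij : (i, j) ∈ D.virtualMatching rank α β b s) {θ : (D.seller j).supp}
    (hθ : ∃ i', (i', j) ∈ D.virtualMatching rank α β b (Function.update s j θ)) :
    β j θ ≤ α i (b i) := by
  classical
  have hA := D.virtualMatching_mem (rank := rank) (α := α) (β := β) b s
  have hA' := D.virtualMatching_mem (rank := rank) (α := α) (β := β) b (Function.update s j θ)
  have hE : (D.virtualMatching rank α β b s).erase (i, j) ∈ D.feasible :=
    D.downward_closed _ hA _ (Finset.erase_subset _ _)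
  have hnot : ¬ ∃ i', (i', j) ∈ (D.virtualMatching rank α β b s).erase (i, j) := by
    rintro ⟨i', hi'⟩
    obtain ⟨hne, hmem⟩ := Finset.mem_erase.1 hi'
    exact hne (by rw [D.matching_seller _ hA i i' j hij hmem])
  have h1 := D.sum_le_virtualMatching (rank := rank) (α := α) (β := β) b (Function.update s j θ) hE
  have h2 := D.sum_le_virtualMatching (rank := rank) (α := α) (β := β) b s hA'
  rw [D.sum_update_seller b s j θ hE, D.sum_update_seller b s j θ hA', if_neg hnot, if_pos hθ] at h1
  have h3 := Finset.add_sum_erase _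
    (fun e : Fin n × Fin m => α e.1 (b e.1) - β e.2 (s e.2)) hij
  simp only at h3
  linarith

/-- The threshold mechanism that maximizes the virtual surplus for `α` and `β`. -/
noncomputable def virtualMechanism (rank : Finset (Fin n × Fin m) → ℕ) (α : Fin n → ℝ → ℝ)
    (β : Fin m → ℝ → ℝ) : Mechanism D :=
  D.thresholdMechanism (D.virtualMatching rank α β) fun b s => D.virtualMatching_mem b s

theorem thresholdMechanism_expectedWeight {A : D.BProfile → D.SProfile → Finset (Fin n × Fin m)}
    (hA : ∀ b s, A b s ∈ D.feasible) (w : D.BProfile → D.SProfile → Fin n × Fin m → ℝ) :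
    (D.thresholdMechanism A hA).expectedWeight w = D.expect fun b s => ∑ e ∈ A b s, w b s e := by
  rw [Mechanism.expectedWeight]
  congr 1
  funext b s
  simp [thresholdMechanism, hA]

theorem thresholdMechanism_xB {A : D.BProfile → D.SProfile → Finset (Fin n × Fin m)}
    (hA : ∀ b s, A b s ∈ D.feasible) (i : Fin n) (b : D.BProfile) (s : D.SProfile) :
    (D.thresholdMechanism A hA).xB i b s = if ∃ j, (i, j) ∈ A b s then 1 else 0 := by
  simp only [Mechanism.xB, thresholdMechanism, ite_mul, one_mul, zero_mul]
  rw [Finset.sum_ite_eq', if_pos (hA b s)]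

theorem thresholdMechanism_xS {A : D.BProfile → D.SProfile → Finset (Fin n × Fin m)}
    (hA : ∀ b s, A b s ∈ D.feasible) (j : Fin m) (b : D.BProfile) (s : D.SProfile) :
    (D.thresholdMechanism A hA).xS j b s = if ∃ i, (i, j) ∈ A b s then 1 else 0 := by
  simp only [Mechanism.xS, thresholdMechanism, ite_mul, one_mul, zero_mul]
  rw [Finset.sum_ite_eq', if_pos (hA b s)]

theorem thresholdMechanism_payB_update {A : D.BProfile → D.SProfile → Finset (Fin n × Fin m)}
    (hA : ∀ b s, A b s ∈ D.feasible) (i : Fin n) (b : D.BProfile) (s : D.SProfile)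
    (t : (D.buyer i).supp) :
    (D.thresholdMechanism A hA).payB i (Function.update b i t) s =
      if ∃ j, (i, j) ∈ A (Function.update b i t) s then
        sInf {v : ℝ | ∃ t : (D.buyer i).supp, (t : ℝ) = v ∧
          ∃ j, (i, j) ∈ A (Function.update b i t) s}
      else 0 := by
  simp only [thresholdMechanism, Function.update_idem]

theorem thresholdMechanism_payS_update {A : D.BProfile → D.SProfile → Finset (Fin n × Fin m)}
    (hA : ∀ b s, A b s ∈ D.feasible) (j : Fin m) (b : D.BProfile) (s : D.SProfile)
    (t : (D.seller j).supp) :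
    (D.thresholdMechanism A hA).payS j b (Function.update s j t) =
      if ∃ i, (i, j) ∈ A b (Function.update s j t) then
        sSup {v : ℝ | ∃ t : (D.seller j).supp, (t : ℝ) = v ∧
          ∃ i, (i, j) ∈ A b (Function.update s j t)}
      else 0 := by
  simp only [thresholdMechanism, Function.update_idem]

theorem thresholdMechanism_payB_nonneg {A : D.BProfile → D.SProfile → Finset (Fin n × Fin m)}
    (hA : ∀ b s, A b s ∈ D.feasible) (i : Fin n) (b : D.BProfile) (s : D.SProfile) :
    0 ≤ (D.thresholdMechanism A hA).payB i b s := by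
  simp only [thresholdMechanism]
  split_ifs
  · refine Real.sInf_nonneg ?_
    rintro _ ⟨t, rfl, -⟩
    exact (D.buyer i).nonneg t t.2
  · exact le_rfl

theorem thresholdMechanism_payS_nonneg {A : D.BProfile → D.SProfile → Finset (Fin n × Fin m)}
    (hA : ∀ b s, A b s ∈ D.feasible) (j : Fin m) (b : D.BProfile) (s : D.SProfile) :
    0 ≤ (D.thresholdMechanism A hA).payS j b s := by
  simp only [thresholdMechanism]
  split_ifs
  · refine Real.sSup_nonneg ?_
    rintro _ ⟨t, rfl, -⟩
    exact (D.seller j).nonneg t t.2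
  · exact le_rfl

/-- A threshold mechanism whose allocation is monotone in every agent's type is incentive compatible
and individually rational at every profile of the other agents, hence in expectation. -/
theorem virtualMechanism_isIR_isBIC
    (hα : ∀ i, Monotone fun t : (D.buyer i).supp => α i t)
    (hβ : ∀ j, Monotone fun t : (D.seller j).supp => β j t) :
    (D.virtualMechanism rank α β).IsIR ∧ (D.virtualMechanism rank α β).IsBIC := by
  have hB : ∀ i (v : ℝ) t, (D.virtualMechanism rank α β).utilB i v t = D.expect fun b s =>
      v * (D.virtualMechanism rank α β).xB i (Function.update b i t) s
        - (D.virtualMechanism rank α β).payB i (Function.update b i t) s := by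
    intro i v t
    rw [D.expect_sub, D.expect_mul_left]
    rfl
  have hS : ∀ j (v : ℝ) t, (D.virtualMechanism rank α β).utilS j v t = D.expect fun b s =>
      (D.virtualMechanism rank α β).payS j b (Function.update s j t)
        - v * (D.virtualMechanism rank α β).xS j b (Function.update s j t) := by
    intro j v t
    rw [D.expect_sub, D.expect_mul_left]
    rfl
  refine ⟨⟨fun i t => ?_, fun j t => ?_⟩, ⟨fun i t u => ?_, fun j t u => ?_⟩⟩
  · rw [hB]
    refine D.expect_nonneg fun b s => ?_
    rw [virtualMechanism, thresholdMechanism_xB, thresholdMechanism_payB_update]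
    exact ValueDist.buyer_threshold_ir
      (P := fun t => ∃ j, (i, j) ∈ D.virtualMatching rank α β (Function.update b i t) s) t
  · rw [hS]
    refine D.expect_nonneg fun b s => ?_
    rw [virtualMechanism, thresholdMechanism_xS, thresholdMechanism_payS_update]
    exact ValueDist.seller_threshold_ir
      (P := fun t => ∃ i, (i, j) ∈ D.virtualMatching rank α β b (Function.update s j t)) t
  · rw [hB, hB]
    refine D.expect_mono fun b s => ?_
    simp only [virtualMechanism, thresholdMechanism_xB, thresholdMechanism_payB_update]
    exact ValueDist.buyer_threshold_ic
      (P := fun t => ∃ j, (i, j) ∈ D.virtualMatching rank α β (Function.update b i t) s)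
      (D.virtualMatching_buyer_mono b s (hα i)) t u
  · rw [hS, hS]
    refine D.expect_mono fun b s => ?_
    simp only [virtualMechanism, thresholdMechanism_xS, thresholdMechanism_payS_update]
    exact ValueDist.seller_threshold_ic
      (P := fun t => ∃ i, (i, j) ∈ D.virtualMatching rank α β b (Function.update s j t))
      (D.virtualMatching_seller_anti b s (hβ j)) t u

/-- When buyers are ranked by their ironed virtual values, revenue is the expected virtual value of
the trading buyers: the allocation is constant on every ironed interval. -/
theorem virtualMechanism_revenue (rank : Finset (Fin n × Fin m) → ℕ) (β : Fin m → ℝ → ℝ) :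
    ∑ i, D.expect ((D.virtualMechanism rank (fun i => (D.buyer i).ironedPhi) β).payB i)
      = (D.virtualMechanism rank (fun i => (D.buyer i).ironedPhi) β).expectedWeight
          fun b _ e => (D.buyer e.1).ironedPhi (b e.1) := by
  rw [← Mechanism.sum_expect_mul_xB _ fun i => (D.buyer i).ironedPhi]
  refine Finset.sum_congr rfl fun i _ => ?_
  rw [← D.expect_redraw_buyer _ i, ← D.expect_redraw_buyer (fun b s => _ * _) i]
  congr 1
  funext b s
  simp only [virtualMechanism, thresholdMechanism_xB, thresholdMechanism_payB_update,
    Function.update_self]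
  exact ValueDist.buyer_threshold_revenue
    (P := fun t => ∃ j, (i, j) ∈
      D.virtualMatching rank (fun i => (D.buyer i).ironedPhi) β (Function.update b i t) s)
    (D.virtualMatching_buyer_mono b s (D.buyer i).monotone_ironedPhi)
    fun t u h ht => by rwa [← D.virtualMatching_buyer_congr b s h]

/-- When sellers are ranked by their ironed virtual values, their expected gain is the expected
virtual value of the trading sellers. -/
theorem virtualMechanism_gain (rank : Finset (Fin n × Fin m) → ℕ) (α : Fin n → ℝ → ℝ) :
    ∑ j, D.expect ((D.virtualMechanism rank α fun j => (D.seller j).ironedTau).payS j)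
      = (D.virtualMechanism rank α fun j => (D.seller j).ironedTau).expectedWeight
          fun _ s e => (D.seller e.2).ironedTau (s e.2) := by
  rw [← Mechanism.sum_expect_mul_xS _ fun j => (D.seller j).ironedTau]
  refine Finset.sum_congr rfl fun j _ => ?_
  rw [← D.expect_redraw_seller _ j, ← D.expect_redraw_seller (fun b s => _ * _) j]
  congr 1
  funext b s
  simp only [virtualMechanism, thresholdMechanism_xS, thresholdMechanism_payS_update,
    Function.update_self]
  exact ValueDist.seller_threshold_gain
    (P := fun t => ∃ i, (i, j) ∈
      D.virtualMatching rank α (fun j => (D.seller j).ironedTau) b (Function.update s j t))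
    (D.virtualMatching_seller_anti b s (D.seller j).monotone_ironedTau)
    fun t u h ht => by rwa [← D.virtualMatching_seller_congr b s h]

/-- When buyers are ranked by their values, their payments cover the virtual costs. -/
theorem virtualCost_le_revenue (rank : Finset (Fin n × Fin m) → ℕ) (β : Fin m → ℝ → ℝ) :
    ((D.virtualMechanism rank (fun _ t => t) β).expectedWeight fun _ s e => β e.2 (s e.2))
      ≤ ∑ i, D.expect ((D.virtualMechanism rank (fun _ t => t) β).payB i) := by
  rw [virtualMechanism, thresholdMechanism_expectedWeight, ← D.expect_sum]
  refine D.expect_mono fun b s => ?_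
  have h : ∀ i, (D.virtualMechanism rank (fun _ t => t) β).payB i b s
      = (D.virtualMechanism rank (fun _ t => t) β).payB i b s *
        if ∃ j, (i, j) ∈ D.virtualMatching rank (fun _ t => t) β b s then 1 else 0 := by
    intro i
    by_cases hi : ∃ j, (i, j) ∈ D.virtualMatching rank (fun _ t => t) β b s
    · rw [if_pos hi, mul_one]
    · simp [virtualMechanism, thresholdMechanism, hi]
  change _ ≤ ∑ i, (D.virtualMechanism rank (fun _ t => t) β).payB i b s
  rw [Finset.sum_congr rfl fun i _ => h i, ← D.sum_fst (D.virtualMatching_mem b s)]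
  refine Finset.sum_le_sum fun e he => ?_
  obtain ⟨i, j⟩ := e
  obtain ⟨θ, hθ, -, heq⟩ := ValueDist.exists_threshold_buyer
    (P := fun t => ∃ j, (i, j) ∈ D.virtualMatching rank (fun _ t => t) β (Function.update b i t) s)
    ⟨b i, j, by rwa [Function.update_eq_self]⟩
  have hp : (D.virtualMechanism rank (fun _ t => t) β).payB i b s = θ := by
    rw [← heq]
    exact if_pos ⟨j, he⟩
  rw [hp]
  exact D.virtualCost_le_threshold he hθ

/-- When sellers are ranked by their values, their gains are covered by the virtual values. -/
theorem gain_le_virtualValue (rank : Finset (Fin n × Fin m) → ℕ) (α : Fin n → ℝ → ℝ) :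
    ∑ j, D.expect ((D.virtualMechanism rank α fun _ t => t).payS j)
      ≤ (D.virtualMechanism rank α fun _ t => t).expectedWeight fun b _ e => α e.1 (b e.1) := by
  rw [virtualMechanism, thresholdMechanism_expectedWeight, ← D.expect_sum]
  refine D.expect_mono fun b s => ?_
  have h : ∀ j, (D.virtualMechanism rank α fun _ t => t).payS j b s
      = (D.virtualMechanism rank α fun _ t => t).payS j b s *
        if ∃ i, (i, j) ∈ D.virtualMatching rank α (fun _ t => t) b s then 1 else 0 := by
    intro j
    by_cases hj : ∃ i, (i, j) ∈ D.virtualMatching rank α (fun _ t => t) b s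
    · rw [if_pos hj, mul_one]
    · simp [virtualMechanism, thresholdMechanism, hj]
  change ∑ j, (D.virtualMechanism rank α fun _ t => t).payS j b s ≤ _
  rw [Finset.sum_congr rfl fun j _ => h j, ← D.sum_snd (D.virtualMatching_mem b s)]
  refine Finset.sum_le_sum fun e he => ?_
  obtain ⟨i, j⟩ := e
  obtain ⟨θ, hθ, -, heq⟩ := ValueDist.exists_threshold_seller
    (P := fun t => ∃ i, (i, j) ∈ D.virtualMatching rank α (fun _ t => t) b (Function.update s j t))
    ⟨s j, i, by rwa [Function.update_eq_self]⟩
  have hp : (D.virtualMechanism rank α fun _ t => t).payS j b s = θ := by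
    rw [← heq]
    exact if_pos ⟨i, he⟩
  rw [hp]
  exact D.threshold_le_virtualValue he hθ

/-- Without sellers nobody trades and nobody pays. -/
theorem thresholdMechanism_surplus_of_isEmpty [IsEmpty (Fin m)]
    {A : D.BProfile → D.SProfile → Finset (Fin n × Fin m)} (hA : ∀ b s, A b s ∈ D.feasible) :
    (D.thresholdMechanism A hA).surplus = 0 := by
  have h : ∀ i b s, (D.thresholdMechanism A hA).payB i b s = 0 := fun i b s =>
    if_neg fun ⟨j, _⟩ => isEmptyElim j
  simp [Mechanism.surplus, h, D.expect_const]

theorem GSOM_eq : D.GSOM rank =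
    D.virtualMechanism rank (fun i => (D.buyer i).ironedPhi) fun _ t => t := rfl

theorem GBOM_eq : D.GBOM rank =
    D.virtualMechanism rank (fun _ t => t) fun j => (D.seller j).ironedTau := rfl

variable (rank)

theorem GSOM_isIR_isBIC : (D.GSOM rank).IsIR ∧ (D.GSOM rank).IsBIC :=
  D.virtualMechanism_isIR_isBIC (α := fun i => (D.buyer i).ironedPhi) (β := fun _ t => t)
    (fun i => (D.buyer i).monotone_ironedPhi) fun _ _ _ h => h

theorem GBOM_isIR_isBIC : (D.GBOM rank).IsIR ∧ (D.GBOM rank).IsBIC :=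
  D.virtualMechanism_isIR_isBIC (α := fun _ t => t) (β := fun j => (D.seller j).ironedTau)
    (fun _ _ _ h => h) fun j => (D.seller j).monotone_ironedTau

/-- Revenue is the expected virtual value, which covers the sellers' gains. -/
theorem GSOM_surplus_nonneg : 0 ≤ (D.GSOM rank).surplus := by
  rw [Mechanism.surplus_eq, GSOM_eq, virtualMechanism_revenue]
  exact sub_nonneg.2 (D.gain_le_virtualValue rank _)

/-- Expected gains are the expected virtual values, which buyers' payments cover. -/
theorem GBOM_surplus_nonneg : 0 ≤ (D.GBOM rank).surplus := by
  rw [Mechanism.surplus_eq, GBOM_eq, virtualMechanism_gain]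
  exact sub_nonneg.2 (D.virtualCost_le_revenue rank _)

/-- Virtual values do not exceed values, so GSOM gains at least its objective. -/
theorem le_GSOM_GFT :
    D.expect (fun b s => D.maxWeight rank fun e => (D.buyer e.1).ironedPhi (b e.1) - (s e.2 : ℝ))
      ≤ (D.GSOM rank).GFT := by
  have h := (D.GSOM rank).expectedWeight_mono
    (w := fun b s e => (D.buyer e.1).ironedPhi (b e.1) - (s e.2 : ℝ))
    (w' := fun b s e => (b e.1 : ℝ) - (s e.2 : ℝ))
    fun b s e => sub_le_sub_right ((D.buyer e.1).ironedPhi_le (b e.1)) _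
  rw [GSOM, thresholdMechanism_expectedWeight] at h
  exact h

/-- Sellers' virtual values are at least their values, so GBOM gains at least its objective. -/
theorem le_GBOM_GFT :
    D.expect (fun b s => D.maxWeight rank fun e => (b e.1 : ℝ) - (D.seller e.2).ironedTau (s e.2))
      ≤ (D.GBOM rank).GFT := by
  have h := (D.GBOM rank).expectedWeight_mono
    (w := fun b s e => (b e.1 : ℝ) - (D.seller e.2).ironedTau (s e.2))
    (w' := fun b s e => (b e.1 : ℝ) - (s e.2 : ℝ))
    fun b s e => sub_le_sub_left ((D.seller e.2).le_ironedTau (s e.2)) _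
  rw [GBOM, thresholdMechanism_expectedWeight] at h
  exact h

theorem GFT_le_two_mul_better {M : Mechanism D} (hIR : M.IsIR) (hBIC : M.IsBIC)
    (hWBB : M.IsExAnteWBB) :
    M.GFT ≤ 2 * (Mechanism.better (D.GSOM rank) (D.GBOM rank)).GFT := by
  have h := M.GFT_le rank hIR hBIC hWBB
  have h1 := D.le_GSOM_GFT rank
  have h2 := D.le_GBOM_GFT rank
  rw [Mechanism.better]
  split_ifs with h3
  · linarith
  · linarith [not_le.1 h3]

end Market

end DoubleAuction

/-- For every double auction and every fixed tie-breaking order on the matchings (such as the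
lexicographic one), there is an IR, BIC, SBB mechanism whose expected gains from trade are at least
`OPT / 2`, namely the SBB transform of the better of GSOM and GBOM. (`OPT` is a genuine supremum.) -/
theorem mainTheorem1 (n m : ℕ) (D : DoubleAuction.Market n m)
    (rank : Finset (Fin n × Fin m) → ℕ) (hrank : Function.Injective rank) :
    IsLUB D.achievableGFT D.OPT ∧
    ∃ M : DoubleAuction.Mechanism D,
      M.IsIR ∧ M.IsBIC ∧ M.IsSBB ∧ D.OPT / 2 ≤ M.GFT ∧
      M = (DoubleAuction.Mechanism.better (D.GSOM rank) (D.GBOM rank)).sbbTransform := by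
  have hupper : ∀ g ∈ D.achievableGFT,
      g ≤ 2 * (DoubleAuction.Mechanism.better (D.GSOM rank) (D.GBOM rank)).GFT := by
    rintro _ ⟨M, hIR, hBIC, hWBB, rfl⟩
    exact D.GFT_le_two_mul_better rank hIR hBIC hWBB
  have hne : D.achievableGFT.Nonempty := by
    refine ⟨_, D.GSOM rank, (D.GSOM_isIR_isBIC rank).1, (D.GSOM_isIR_isBIC rank).2, ?_, rfl⟩
    have h := D.GSOM_surplus_nonneg rank
    rw [DoubleAuction.Mechanism.surplus, D.expect_sub] at h
    exact sub_nonneg.1 h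
  refine ⟨isLUB_csSup hne ⟨_, hupper⟩,
    (DoubleAuction.Mechanism.better (D.GSOM rank) (D.GBOM rank)).sbbTransform, ?_⟩
  have hhalf : D.OPT / 2 ≤ (DoubleAuction.Mechanism.better (D.GSOM rank) (D.GBOM rank)).GFT := by
    have : D.OPT ≤ _ := csSup_le hne hupper
    linarith
  have hspec : (DoubleAuction.Mechanism.better (D.GSOM rank) (D.GBOM rank)).sbbTransform.IsIR ∧
      (DoubleAuction.Mechanism.better (D.GSOM rank) (D.GBOM rank)).sbbTransform.IsBIC ∧
      (DoubleAuction.Mechanism.better (D.GSOM rank) (D.GBOM rank)).sbbTransform.IsSBB := by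
    rw [DoubleAuction.Mechanism.better]
    split_ifs
    · refine DoubleAuction.Mechanism.sbbTransform_spec _ (D.GSOM_isIR_isBIC rank).1
        (D.GSOM_isIR_isBIC rank).2 (D.thresholdMechanism_payB_nonneg _)
        (D.thresholdMechanism_payS_nonneg _) (D.GSOM_surplus_nonneg rank) ?_
      rintro rfl
      exact D.thresholdMechanism_surplus_of_isEmpty _
    · refine DoubleAuction.Mechanism.sbbTransform_spec _ (D.GBOM_isIR_isBIC rank).1
        (D.GBOM_isIR_isBIC rank).2 (D.thresholdMechanism_payB_nonneg _)
        (D.thresholdMechanism_payS_nonneg _) (D.GBOM_surplus_nonneg rank) ?_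
      rintro rfl
      exact D.thresholdMechanism_surplus_of_isEmpty _
  -- the transform keeps the allocation, so its gains from trade are definitionally those in `hhalf`
  exact ⟨hspec.1, hspec.2.1, hspec.2.2, hhalf, rfl⟩
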